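/- Let $X$ be either $\mathbf S^3$ (the unit sphere of $\mathbb R^4$) or $\mathbb R^3$. Let $M\subset X$ be a Dupin cyclide without its singular points, i.e. an image under a conformal (Möbius) transformation of $\mathbf S^3=\mathbb R^3\cup\{\infty\}$ (with the point sent to infinity omitted if $X=\mathbb R^3$) of one of the following surfaces: the boundary of the tubular neighbourhood of radius $r$, $0<r<\pi/2$, of a geodesic of $\mathbf S^3$; a cylinder of revolution in $\mathbb R^3$; a cone of revolution in $\mathbb R^3$ minus its apex. Then there are a continuous unit normal field $\nu$ on $M$ and continuous unit vector fields $X_1,X_2$ tangent to $M$ and orthogonal to each other that are at every point principal directions for principal curvatures $k_1>k_2$ with respect to $\nu$. Fix any such $\nu,X_1,X_2$. For $\alpha\in(-\pi/2,\pi/2]$ let $\mathcal F_\alpha^{+}$ and $\mathcal F_\alpha^{-}$ be the foliations of $M$ whose leaves are tangent to the lines spanned by $\cos\alpha\,X_1+\sin\alpha\,X_2$ and by $\cos\alpha\,X_1-\sin\alpha\,X_2$, that is, make the constant angle $\alpha$, respectively $-\alpha$, with the lines of curvature of $k_1$. Call a regular curve of class $C^3$ on $M$, parametrized by an open interval, a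 Darboux curve if at each of its points some osculating sphere of the curve (a sphere, or plane if $X=\mathbb R^3$, having contact of order at least $3$ with the curve there) is tangent to $M$. Then a regular curve of class $C^3$ on $M$ is a Darboux curve if and only if it is an arc of a leaf of $\mathcal F_\alpha^+$ or of $\mathcal F_\alpha^-$ for some $\alpha\in(-\pi/2,\pi/2]$. Moreover a subset of $M$ is the trace of a maximal Darboux curve if and only if it is a leaf of $\mathcal F_\alpha^+$ or of $\mathcal F_\alpha^-$ for some $\alpha\in(-\pi/2,\pi/2]$. -/

import Mathlib

open Set Filter Topology

noncomputable section

namespace Cyclide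

section Surface

variable {E : Type*} [NormedAddCommGroup E] [InnerProductSpace ℝ E]

/-! In this section `X` is the ambient three-dimensional space, a subset of the Euclidean space `E`;
it will be `ℝ³` itself (`E = ℝ³`, `X = univ`) or the unit sphere `S³` of `E = ℝ⁴`.
The surface is a subset `M` of `X`. -/

/-- `v` is a tangent vector of the subset `M` at the point `m`: it is the velocity at `m` of a
curve drawn on `M`. -/
def IsTangentVector (M : Set E) (m v : E) : Prop :=
  ∃ γ : ℝ → E, γ 0 = m ∧ (∀ᶠ t in 𝓝 (0 : ℝ), γ t ∈ M) ∧ HasDerivAt γ v 0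

/-- `ν` is a (continuous) unit normal field of the surface `M` in the ambient space `X`. -/
structure IsUnitNormal (X M : Set E) (ν : E → E) : Prop where
  continuousOn : ContinuousOn ν M
  norm_eq_one : ∀ m ∈ M, ‖ν m‖ = 1
  tangent_ambient : ∀ m ∈ M, IsTangentVector X m (ν m)
  normal : ∀ m ∈ M, ∀ v, IsTangentVector M m v → inner ℝ (ν m) v = 0

/-- The tangent vector `e` of `M` at `m` satisfies `dν (e) = - k e`. For `e ≠ 0` this says that
`e` spans a principal direction and that `k` is the corresponding principal curvature. -/
def IsPrincipalVector (M : Set E) (ν : E → E) (m : E) (k : ℝ) (e : E) : Prop :=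
  IsTangentVector M m e ∧
    ∀ γ : ℝ → E, γ 0 = m → (∀ᶠ t in 𝓝 (0 : ℝ), γ t ∈ M) → HasDerivAt γ e 0 →
      HasDerivAt (fun t => ν (γ t)) (-(k • e)) 0

/-- `ν` is a unit normal field of `M` and `(X₁, X₂)` is a continuous orthonormal tangent frame on
`M` such that `X₁` is tangent to the first principal foliation (curvature `k₁`) and `X₂` to the
second (curvature `k₂`), where `k₁ > k₂`. In particular `M` has no umbilic point.
The angles on `M` are counted with the orientation given by `(X₁, X₂)`. -/
structure IsPrincipalFrame (X M : Set E) (ν X₁ X₂ : E → E) : Prop where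
  isUnitNormal : IsUnitNormal X M ν
  continuousOn_fst : ContinuousOn X₁ M
  continuousOn_snd : ContinuousOn X₂ M
  norm_fst : ∀ m ∈ M, ‖X₁ m‖ = 1
  norm_snd : ∀ m ∈ M, ‖X₂ m‖ = 1
  inner_eq_zero : ∀ m ∈ M, inner ℝ (X₁ m) (X₂ m) = 0
  principal : ∀ m ∈ M, ∃ k₁ k₂ : ℝ, k₂ < k₁ ∧
    IsPrincipalVector M ν m k₁ (X₁ m) ∧ IsPrincipalVector M ν m k₂ (X₂ m)

/-- `c` is a regular curve of class `C³` on `M`, parametrized by the nonempty open interval `I`. -/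
structure IsRegularCurveOn (M : Set E) (I : Set ℝ) (c : ℝ → E) : Prop where
  isOpen : IsOpen I
  ordConnected : I.OrdConnected
  nonempty : I.Nonempty
  contDiffOn : ContDiffOn ℝ 3 c I
  mapsTo : MapsTo c I M
  deriv_ne_zero : ∀ t ∈ I, deriv c t ≠ 0

/-- The left-hand side of the equation `a ‖x‖² + ⟪b, x⟫ + d = 0` of a sphere. In `ℝ³` these are the
spheres and the planes; on `S³` these are the sections by affine hyperplanes. -/
def sphereEq (a : ℝ) (b : E) (d : ℝ) (x : E) : ℝ :=
  a * ‖x‖ ^ 2 + inner ℝ b x + d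

/-- The sphere `{x ∈ X | a ‖x‖² + ⟪b, x⟫ + d = 0}` of `X` is tangent to `M` at `m`: it passes
through `m`, it is a regular surface of `X` at `m`
(so that the equation is not that of a point or of the whole space),
and each vector tangent to `M` at `m` is tangent to it. -/
def IsTangentSphere (X M : Set E) (m : E) (a : ℝ) (b : E) (d : ℝ) : Prop :=
  sphereEq a b d m = 0 ∧
  (∃ w, IsTangentVector X m w ∧ fderiv ℝ (sphereEq a b d) m w ≠ 0) ∧
  ∀ v, IsTangentVector M m v → fderiv ℝ (sphereEq a b d) m v = 0

/-- The sphere `a ‖x‖² + ⟪b, x⟫ + d = 0` osculates the curve `c` at `c t`: it has contact of order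
at least `3` with the curve there. -/
def IsOsculatingSphere (c : ℝ → E) (t : ℝ) (a : ℝ) (b : E) (d : ℝ) : Prop :=
  ∀ j ≤ 3, iteratedDeriv j (fun s => sphereEq a b d (c s)) t = 0

/-- `c`, defined on the open interval `I`, is a Darboux curve of the surface `M` of `X`: at each of
its points it has an osculating sphere that is tangent to `M` there. -/
def IsDarbouxCurve (X M : Set E) (I : Set ℝ) (c : ℝ → E) : Prop :=
  IsRegularCurveOn M I c ∧
    ∀ t ∈ I, ∃ (a : ℝ) (b : E) (d : ℝ),
      IsTangentSphere X M (c t) a b d ∧ IsOsculatingSphere c t a b d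

/-- The line field that makes the angle `α` with `X₁`. -/
def plusField (X₁ X₂ : E → E) (α : ℝ) (m : E) : Submodule ℝ E :=
  Submodule.span ℝ {Real.cos α • X₁ m + Real.sin α • X₂ m}

/-- The line field that makes the angle `-α` with `X₁`. -/
def minusField (X₁ X₂ : E → E) (α : ℝ) (m : E) : Submodule ℝ E :=
  Submodule.span ℝ {Real.cos α • X₁ m - Real.sin α • X₂ m}

/-- `c`, defined on the open interval `I`, is an integral curve on `M` of the line field `D`, that
is, an arc of a leaf of the foliation of `M` that is tangent to `D`. -/
def IsArcOfLeaf (D : E → Submodule ℝ E) (M : Set E) (I : Set ℝ) (c : ℝ → E) : Prop :=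
  IsRegularCurveOn M I c ∧ ∀ t ∈ I, deriv c t ∈ D (c t)

/-- `L` is the trace of a maximal curve of the class `Q`: of a curve parametrized by arc length
which does not extend, as a curve of class `Q` parametrized by arc length, to a larger open
interval. -/
def IsMaximalTrace (Q : Set ℝ → (ℝ → E) → Prop) (L : Set E) : Prop :=
  ∃ (I : Set ℝ) (c : ℝ → E), Q I c ∧ (∀ t ∈ I, ‖deriv c t‖ = 1) ∧
    (∀ (J : Set ℝ) (c' : ℝ → E), Q J c' → (∀ t ∈ J, ‖deriv c' t‖ = 1) →
      I ⊆ J → EqOn c' c I → J = I) ∧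
    L = c '' I

/-- `L` is a leaf of the foliation of `M` that is tangent to the line field `D`. -/
def IsLeaf (D : E → Submodule ℝ E) (M : Set E) (L : Set E) : Prop :=
  IsMaximalTrace (IsArcOfLeaf D M) L

/-- `L` is the trace of a maximal Darboux curve of the surface `M` of `X`. -/
def IsMaximalDarbouxCurve (X M : Set E) (L : Set E) : Prop :=
  IsMaximalTrace (IsDarbouxCurve X M) L

end Surface

/-- The Euclidean space `ℝ³`. -/
abbrev E3 : Type := EuclideanSpace ℝ (Fin 3)

/-- The Euclidean space `ℝ⁴`. -/
abbrev E4 : Type := EuclideanSpace ℝ (Fin 4)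

/-- The unit sphere of `ℝ⁴`. -/
def S3 : Set E4 := Metric.sphere 0 1

/-- The Lorentz quadratic form on `ℝ × ℝ⁴`. -/
def lorentz (p : ℝ × E4) : ℝ := ‖p.2‖ ^ 2 - p.1 ^ 2

/-- The conformal (Möbius) transformation of `S³` induced by a linear isometry `A` of the Lorentz
form, a point `x` of `S³` being identified with the light ray spanned by `(1, x)`. -/
def moebius (A : (ℝ × E4) →ₗ[ℝ] (ℝ × E4)) (x : E4) : E4 :=
  (A (1, x)).1⁻¹ • (A (1, x)).2

/-- The inverse of the stereographic projection, a conformal map from `ℝ³` onto `S³` without its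
north pole. -/
def invStereo (x : E3) : E4 :=
  !₂[2 * x 0 / (‖x‖ ^ 2 + 1), 2 * x 1 / (‖x‖ ^ 2 + 1), 2 * x 2 / (‖x‖ ^ 2 + 1),
    (‖x‖ ^ 2 - 1) / (‖x‖ ^ 2 + 1)]

/-- A geodesic (great circle) of `S³`. All others are images of it under rotations of `S³`. -/
def greatCircle : Set E4 := {y | y ∈ S3 ∧ y 2 = 0 ∧ y 3 = 0}

/-- The torus formed by the points of `S³` at spherical distance `r` from the geodesic. -/
def geodesicTube (r : ℝ) : Set E4 :=
  {x | x ∈ S3 ∧ IsLeast ((fun y => InnerProductGeometry.angle x y) '' greatCircle) r}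

/-- The cylinder of revolution of radius `R`. -/
def cylinder (R : ℝ) : Set E3 := {x | x 0 ^ 2 + x 1 ^ 2 = R ^ 2}

/-- The cone of revolution of half-angle `θ`, without its singular point. -/
def cone (θ : ℝ) : Set E3 := {x | x ≠ 0 ∧ x 0 ^ 2 + x 1 ^ 2 = (Real.tan θ * x 2) ^ 2}

/-- The model Dupin cyclides, seen in `S³`. -/
def IsModelCyclide (N : Set E4) : Prop :=
  (∃ r : ℝ, 0 < r ∧ r < Real.pi / 2 ∧ N = geodesicTube r) ∨
  (∃ R : ℝ, 0 < R ∧ N = invStereo '' cylinder R) ∨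
  (∃ θ : ℝ, 0 < θ ∧ θ < Real.pi / 2 ∧ N = invStereo '' cone θ)

/-- The Dupin cyclides of `S³` (without their singular points): the images of the models under the
conformal transformations of `S³`. -/
def IsDupinCyclideS3 (M : Set E4) : Prop :=
  ∃ (N : Set E4) (A : (ℝ × E4) →ₗ[ℝ] (ℝ × E4)),
    IsModelCyclide N ∧ (∀ p, lorentz (A p) = lorentz p) ∧ M = moebius A '' N

/-- The Dupin cyclides of `ℝ³` (without their singular points): the stereographic projections of
those of `S³`, a point of the latter at the north pole being sent to infinity. -/
def IsDupinCyclideE3 (M : Set E3) : Prop :=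
  ∃ N : Set E4, IsDupinCyclideS3 N ∧ M = invStereo ⁻¹' N

end Cyclide

end

/-! Everything takes place in the Lorentz space `ℝ × E4`. `S³` and `ℝ³` are two isometrically
embedded sections of its light cone, Möbius maps are linear isometries, and a sphere is a vector `σ`
that contains the point lifted to `G` when `B σ G = 0`. A Dupin cyclide is the set of light rays on
which two skew endomorphisms with `T₁ T₂ = T₂ T₁ = 0` have equal positive squares: two rotations for
the torus, a rotation and a translation for the cylinder, a rotation and a homothety for the cone.
Conjugating the pair by an isometry gives the Möbius images
(`exists_isSkewPair_of_isDupinCyclideS3`), so one argument serves all cases.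

The velocities `T₁ G` and `T₂ G` give orthogonal directions on the surface. Since `T₁³ = -a T₁` and
`T₂³ = -b T₂`, the operator `R = T₁² - T₂²`, which yields the normal, acts on `T₁ G` by `-a` and on
`T₂ G` by `b`. Hence these directions are principal, with distinct curvatures because `a + b > 0`.

Rescale the lift of a curve to `F` with both squares equal to `1`; then `F' = u T₁ F + v T₂ F`. For
a sphere `σ` tangent to the surface put `p = B σ (T₁² F)` and `r = B σ (T₂² F)`. The second and
third derivatives of `B σ F` are `u² p + v² r` and `3 (u u' p + v v' r)`, and regularity of the
sphere means `p ≠ r`. As every pair `(p, r)` comes from some tangent `σ`, an osculating tangent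
sphere exists exactly when the determinant `u v (u v' - v u')` vanishes
(`exists_tangent_osculating_iff`). Up to a positive factor this is the derivative of `v² / (u² +
v²)`, the squared sine of the angle with the first direction. So Darboux curves are the curves of
constant angle, up to a sign that is fixed by connectedness.

For maximal curves, two constant-angle line fields that agree at one point agree everywhere, so an
extension of a leaf by a Darboux curve stays in the same foliation. -/

noncomputable section

namespace Cyclide

/-! ### Calculus on an interval -/

section Calculus

/-- The relation fixes `(g - 1/2)²`, and a continuous function on an interval cannot jump between
the two square roots. This recovers `g` from `g (1 - g)`, which does not see an exchange of the two
principal directions. -/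
theorem eq_of_mul_one_sub_const {I : Set ℝ} (hI : IsPreconnected I)
    {g : ℝ → ℝ} (hg : ContinuousOn g I) {k : ℝ} (h : ∀ t ∈ I, g t * (1 - g t) = k) :
    ∀ s ∈ I, ∀ t ∈ I, g s = g t := by
  intro s hs t ht
  have hsq : ∀ t ∈ I, (g t - 1 / 2) ^ 2 = 1 / 4 - k := fun t ht => by
    rw [← h t ht]; ring
  by_cases hk : g s - 1 / 2 = 0
  · have h1 := hsq s hs
    have h2 := hsq t ht
    rw [← h1, hk] at h2
    have h3 : g t - 1 / 2 = 0 := by simpa using h2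
    linarith
  · have := hI.eq_or_eq_neg_of_sq_eq (f := fun t => g t - 1 / 2) (g := fun _ => g s - 1 / 2)
      (hg.sub continuousOn_const) continuousOn_const
      (fun t ht => by simp only [Pi.pow_apply]; rw [hsq t ht, hsq s hs]) (fun _ => hk)
    rcases this with h1 | h1
    · have h2 := h1 ht
      simp only at h2
      linarith
    · have h2 := h1 hs
      simp only [Pi.neg_apply] at h2
      exact absurd (by linarith) hk

theorem iteratedDeriv_eq_of_hasDerivAt_chain {I : Set ℝ} (hI : IsOpen I) {f₀ f₁ f₂ f₃ : ℝ → ℝ}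
    (h₁ : ∀ t ∈ I, HasDerivAt f₀ (f₁ t) t) (h₂ : ∀ t ∈ I, HasDerivAt f₁ (f₂ t) t)
    (h₃ : ∀ t ∈ I, HasDerivAt f₂ (f₃ t) t) {t : ℝ} (ht : t ∈ I) :
    iteratedDeriv 1 f₀ t = f₁ t ∧ iteratedDeriv 2 f₀ t = f₂ t ∧ iteratedDeriv 3 f₀ t = f₃ t := by
  have e₁ : ∀ t ∈ I, iteratedDeriv 1 f₀ t = f₁ t := fun t ht => by
    rw [iteratedDeriv_one]; exact (h₁ t ht).deriv
  have e₂ : ∀ t ∈ I, iteratedDeriv 2 f₀ t = f₂ t := fun t ht => by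
    rw [iteratedDeriv_succ]
    have : iteratedDeriv 1 f₀ =ᶠ[𝓝 t] f₁ := by
      filter_upwards [hI.mem_nhds ht] with s hs using e₁ s hs
    rw [this.deriv_eq]
    exact (h₂ t ht).deriv
  refine ⟨e₁ t ht, e₂ t ht, ?_⟩
  rw [iteratedDeriv_succ]
  have : iteratedDeriv 2 f₀ =ᶠ[𝓝 t] f₂ := by
    filter_upwards [hI.mem_nhds ht] with s hs using e₂ s hs
  rw [this.deriv_eq]
  exact (h₃ t ht).deriv

/-- Leibniz' rule. It makes the order of contact independent of the scaling of the lift. -/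
theorem iteratedDeriv_mul_eq_zero {f h : ℝ → ℝ} {t : ℝ} (hf : ContDiffAt ℝ 3 f t)
    (hh : ContDiffAt ℝ 3 h t) (h0 : ∀ j ≤ 3, iteratedDeriv j f t = 0) :
    ∀ j ≤ 3, iteratedDeriv j (fun s => h s * f s) t = 0 := by
  intro j hj
  have hj' : ((j : ℕ) : WithTop ℕ∞) ≤ 3 := by exact_mod_cast hj
  rw [iteratedDeriv_fun_mul (hh.of_le hj') (hf.of_le hj')]
  refine Finset.sum_eq_zero fun i _ => ?_
  rw [h0 (j - i) (by omega), mul_zero]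

theorem hasDerivAt_bilin {V W : Type*} [NormedAddCommGroup V] [NormedSpace ℝ V]
    [NormedAddCommGroup W] [NormedSpace ℝ W] (B : V →L[ℝ] W →L[ℝ] ℝ)
    {f : ℝ → V} {g : ℝ → W} {f' : V} {g' : W} {t : ℝ} (hf : HasDerivAt f f' t)
    (hg : HasDerivAt g g' t) :
    HasDerivAt (fun s => B (f s) (g s)) (B f' (g t) + B (f t) g') t :=
  (B.hasFDerivAt.comp_hasDerivAt t hf).clm_apply hg

theorem hasDerivAt_clm {V W : Type*} [NormedAddCommGroup V] [NormedSpace ℝ V]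
    [NormedAddCommGroup W] [NormedSpace ℝ W] (T : V →L[ℝ] W)
    {f : ℝ → V} {f' : V} {t : ℝ} (hf : HasDerivAt f f' t) :
    HasDerivAt (fun s => T (f s)) (T f') t :=
  T.hasFDerivAt.comp_hasDerivAt t hf

theorem eq_zero_of_hasDerivAt_of_eventually_const {f : ℝ → ℝ} {f' k t : ℝ} (hf : HasDerivAt f f' t)
    (h : ∀ᶠ s in 𝓝 t, f s = k) : f' = 0 :=
  hf.unique ((hasDerivAt_const t k).congr_of_eventuallyEq h)

end Calculus

/-! ### Linear algebra of a skew pair -/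

section Algebra

variable {V : Type*} [NormedAddCommGroup V] [NormedSpace ℝ V]

/-- Two commuting skew endomorphisms `T₁`, `T₂` of a five-dimensional quadratic space, which generate
a two-dimensional group of isometries. -/
structure IsSkewPair (B : V →L[ℝ] V →L[ℝ] ℝ) (T₁ T₂ : V →L[ℝ] V) (a b : ℝ) : Prop where
  finrank_eq : Module.finrank ℝ V = 5
  symm : ∀ x y, B x y = B y x
  skew_fst : ∀ x y, B (T₁ x) y = -B x (T₁ y)
  skew_snd : ∀ x y, B (T₂ x) y = -B x (T₂ y)
  fst_snd : ∀ x, T₁ (T₂ x) = 0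
  snd_fst : ∀ x, T₂ (T₁ x) = 0
  fst_cube : ∀ x, T₁ (T₁ (T₁ x)) = -(a • T₁ x)
  snd_cube : ∀ x, T₂ (T₂ (T₂ x)) = -(b • T₂ x)
  add_pos : 0 < a + b

/-- The points `G` of the null cone where the squares of `T₁ G` and `T₂ G` are equal to `q`. -/
structure OnCone (B : V →L[ℝ] V →L[ℝ] ℝ) (T₁ T₂ : V →L[ℝ] V) (q : ℝ) (G : V) : Prop where
  null : B G G = 0
  fst : B (T₁ G) (T₁ G) = q
  snd : B (T₂ G) (T₂ G) = q

variable {B : V →L[ℝ] V →L[ℝ] ℝ} {T₁ T₂ : V →L[ℝ] V} {a b q : ℝ} {G : V}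

theorem IsSkewPair.self_eq_zero {T : V →L[ℝ] V} (symm : ∀ x y, B x y = B y x)
    (skew : ∀ x y, B (T x) y = -B x (T y)) (x : V) : B x (T x) = 0 := by
  have h1 := skew x x
  have h2 := symm x (T x)
  linarith

/-- The Gram matrix of `G, T₁ G, T₂ G, T₁² G, T₂² G`. -/
theorem IsSkewPair.gram (h : IsSkewPair B T₁ T₂ a b) (hG : OnCone B T₁ T₂ q G) :
    (B G G = 0 ∧ B G (T₁ G) = 0 ∧ B G (T₂ G) = 0 ∧ B G (T₁ (T₁ G)) = -q ∧ B G (T₂ (T₂ G)) = -q) ∧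
    (B (T₁ G) G = 0 ∧ B (T₁ G) (T₁ G) = q ∧ B (T₁ G) (T₂ G) = 0 ∧ B (T₁ G) (T₁ (T₁ G)) = 0 ∧
      B (T₁ G) (T₂ (T₂ G)) = 0) ∧
    (B (T₂ G) G = 0 ∧ B (T₂ G) (T₁ G) = 0 ∧ B (T₂ G) (T₂ G) = q ∧ B (T₂ G) (T₁ (T₁ G)) = 0 ∧
      B (T₂ G) (T₂ (T₂ G)) = 0) ∧
    (B (T₁ (T₁ G)) G = -q ∧ B (T₁ (T₁ G)) (T₁ G) = 0 ∧ B (T₁ (T₁ G)) (T₂ G) = 0 ∧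
      B (T₁ (T₁ G)) (T₁ (T₁ G)) = a * q ∧ B (T₁ (T₁ G)) (T₂ (T₂ G)) = 0) ∧
    (B (T₂ (T₂ G)) G = -q ∧ B (T₂ (T₂ G)) (T₁ G) = 0 ∧ B (T₂ (T₂ G)) (T₂ G) = 0 ∧
      B (T₂ (T₂ G)) (T₁ (T₁ G)) = 0 ∧ B (T₂ (T₂ G)) (T₂ (T₂ G)) = b * q) := by
  have s1 := IsSkewPair.self_eq_zero h.symm h.skew_fst
  have s2 := IsSkewPair.self_eq_zero h.symm h.skew_snd
  have g14 : B (T₁ (T₁ G)) (T₁ (T₁ G)) = a * q := by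
    rw [h.skew_fst, h.fst_cube, map_neg, map_smul, neg_neg, hG.fst, smul_eq_mul]
  have g24 : B (T₂ (T₂ G)) (T₂ (T₂ G)) = b * q := by
    rw [h.skew_snd, h.snd_cube, map_neg, map_smul, neg_neg, hG.snd, smul_eq_mul]
  have g03 : B G (T₁ (T₁ G)) = -q := by
    rw [← neg_eq_iff_eq_neg, ← h.skew_fst, hG.fst]
  have g04 : B G (T₂ (T₂ G)) = -q := by
    rw [← neg_eq_iff_eq_neg, ← h.skew_snd, hG.snd]
  have g12 : B (T₁ G) (T₂ G) = 0 := by rw [h.skew_fst, h.fst_snd, map_zero, neg_zero]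
  have g14' : B (T₁ G) (T₂ (T₂ G)) = 0 := by rw [h.skew_fst, h.fst_snd, map_zero, neg_zero]
  have g23 : B (T₂ G) (T₁ (T₁ G)) = 0 := by rw [h.skew_snd, h.snd_fst, map_zero, neg_zero]
  have g34 : B (T₁ (T₁ G)) (T₂ (T₂ G)) = 0 := by rw [h.skew_fst, h.fst_snd, map_zero, neg_zero]
  refine ⟨⟨hG.null, s1 G, s2 G, g03, g04⟩, ⟨?_, hG.fst, g12, s1 _, g14'⟩,
    ⟨?_, ?_, hG.snd, g23, s2 _⟩, ⟨?_, ?_, ?_, g14, g34⟩, ⟨?_, ?_, ?_, ?_, g24⟩⟩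
  · rw [h.symm, s1]
  · rw [h.symm, s2]
  · rw [h.symm, g12]
  · rw [h.symm, g03]
  · rw [h.symm, s1]
  · rw [h.symm, g23]
  · rw [h.symm, g04]
  · rw [h.symm, g14']
  · rw [h.symm, s2]
  · rw [h.symm, g34]

/-- The Gram determinant of the five vectors is `-q⁵ (a + b)`, which is nonzero, so they form a
basis of the five-dimensional space. -/
theorem IsSkewPair.exists_combination (h : IsSkewPair B T₁ T₂ a b) (hG : OnCone B T₁ T₂ q G)
    (hq : 0 < q) (W : V) : ∃ w₀ w₁ w₂ w₃ w₄ : ℝ,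
      W = w₀ • G + w₁ • T₁ G + w₂ • T₂ G + w₃ • T₁ (T₁ G) + w₄ • T₂ (T₂ G) := by
  obtain ⟨⟨g00, g01, g02, g03, g04⟩, ⟨g10, g11, g12, g13, g14⟩, ⟨g20, g21, g22, g23, g24⟩,
    ⟨g30, g31, g32, g33, g34⟩, ⟨g40, g41, g42, g43, g44⟩⟩ := h.gram hG
  have hab := h.add_pos
  let v : Fin 5 → V := ![G, T₁ G, T₂ G, T₁ (T₁ G), T₂ (T₂ G)]
  have hli : LinearIndependent ℝ v := by
    rw [Fintype.linearIndependent_iff]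
    intro w hw
    simp only [v, Fin.sum_univ_five, Matrix.cons_val] at hw
    have k0 := congrArg (fun x => B G x) hw
    have k1 := congrArg (fun x => B (T₁ G) x) hw
    have k2 := congrArg (fun x => B (T₂ G) x) hw
    have k3 := congrArg (fun x => B (T₁ (T₁ G)) x) hw
    have k4 := congrArg (fun x => B (T₂ (T₂ G)) x) hw
    simp only [map_add, map_smul, map_zero, smul_eq_mul, g00, g01, g02, g03, g04] at k0
    simp only [map_add, map_smul, map_zero, smul_eq_mul, g10, g11, g12, g13, g14] at k1
    simp only [map_add, map_smul, map_zero, smul_eq_mul, g20, g21, g22, g23, g24] at k2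
    simp only [map_add, map_smul, map_zero, smul_eq_mul, g30, g31, g32, g33, g34] at k3
    simp only [map_add, map_smul, map_zero, smul_eq_mul, g40, g41, g42, g43, g44] at k4
    have z1 : w 1 = 0 := by
      have : w 1 * q = 0 := by linarith
      exact (mul_eq_zero.1 this).resolve_right hq.ne'
    have z2 : w 2 = 0 := by
      have : w 2 * q = 0 := by linarith
      exact (mul_eq_zero.1 this).resolve_right hq.ne'
    have z34 : w 4 = -w 3 := by
      have : (w 3 + w 4) * q = 0 := by linarith
      linarith [(mul_eq_zero.1 this).resolve_right hq.ne']
    have z3 : w 3 = 0 := by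
      rw [z34] at k4
      have : w 3 * ((a + b) * q) = 0 := by linarith
      exact (mul_eq_zero.1 this).resolve_right (mul_pos hab hq).ne'
    have z0 : w 0 = 0 := by
      rw [z3] at k3
      have : w 0 * q = 0 := by linarith
      exact (mul_eq_zero.1 this).resolve_right hq.ne'
    intro i
    fin_cases i
    · exact z0
    · exact z1
    · exact z2
    · exact z3
    · simpa [z3] using z34
  let bs := basisOfLinearIndependentOfCardEqFinrank hli (by simp [h.finrank_eq])
  refine ⟨bs.repr W 0, bs.repr W 1, bs.repr W 2, bs.repr W 3, bs.repr W 4, ?_⟩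
  conv_lhs => rw [← bs.sum_repr W]
  simp [Fin.sum_univ_five, bs, v]

/-- The orthogonal of `G` and `T₁² G - T₂² G` is spanned by `G`, `T₁ G`, `T₂ G`. -/
theorem IsSkewPair.exists_tangent_combination (h : IsSkewPair B T₁ T₂ a b)
    (hG : OnCone B T₁ T₂ q G) (hq : 0 < q) {W : V} (h0 : B G W = 0)
    (h1 : B (T₁ (T₁ G)) W = B (T₂ (T₂ G)) W) :
    ∃ w₀ w₁ w₂ : ℝ, W = w₀ • G + w₁ • T₁ G + w₂ • T₂ G := by
  obtain ⟨⟨g00, g01, g02, g03, g04⟩, ⟨g10, g11, g12, g13, g14⟩, ⟨g20, g21, g22, g23, g24⟩,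
    ⟨g30, g31, g32, g33, g34⟩, ⟨g40, g41, g42, g43, g44⟩⟩ := h.gram hG
  have hab := h.add_pos
  obtain ⟨w₀, w₁, w₂, w₃, w₄, rfl⟩ := h.exists_combination hG hq W
  simp only [map_add, map_smul, smul_eq_mul, g00, g01, g02, g03, g04] at h0
  simp only [map_add, map_smul, smul_eq_mul, g30, g31, g32, g33, g34, g40, g41, g42, g43, g44]
    at h1
  have z34 : w₄ = -w₃ := by
    have : (w₃ + w₄) * q = 0 := by linarith
    linarith [(mul_eq_zero.1 this).resolve_right hq.ne']
  have z3 : w₃ = 0 := by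
    rw [z34] at h1
    have : w₃ * ((a + b) * q) = 0 := by linarith
    exact (mul_eq_zero.1 this).resolve_right (mul_pos hab hq).ne'
  exact ⟨w₀, w₁, w₂, by simp [z34, z3]⟩

/-- The orthogonal of `G`, `T₁ G`, `T₂ G` is spanned by `G` and `T₁² G - T₂² G`. -/
theorem IsSkewPair.exists_normal_combination (h : IsSkewPair B T₁ T₂ a b)
    (hG : OnCone B T₁ T₂ q G) (hq : 0 < q) {W : V} (h0 : B G W = 0)
    (h1 : B (T₁ G) W = 0) (h2 : B (T₂ G) W = 0) :
    ∃ x y : ℝ, W = x • G + y • (T₁ (T₁ G) - T₂ (T₂ G)) := by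
  obtain ⟨⟨g00, g01, g02, g03, g04⟩, ⟨g10, g11, g12, g13, g14⟩, ⟨g20, g21, g22, g23, g24⟩,
    ⟨g30, g31, g32, g33, g34⟩, ⟨g40, g41, g42, g43, g44⟩⟩ := h.gram hG
  obtain ⟨w₀, w₁, w₂, w₃, w₄, rfl⟩ := h.exists_combination hG hq W
  simp only [map_add, map_smul, smul_eq_mul, g00, g01, g02, g03, g04] at h0
  simp only [map_add, map_smul, smul_eq_mul, g10, g11, g12, g13, g14] at h1
  simp only [map_add, map_smul, smul_eq_mul, g20, g21, g22, g23, g24] at h2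
  have z34 : w₄ = -w₃ := by
    have : (w₃ + w₄) * q = 0 := by linarith
    linarith [(mul_eq_zero.1 this).resolve_right hq.ne']
  have z1 : w₁ = 0 := by
    have : w₁ * q = 0 := by linarith
    exact (mul_eq_zero.1 this).resolve_right hq.ne'
  have z2 : w₂ = 0 := by
    have : w₂ * q = 0 := by linarith
    exact (mul_eq_zero.1 this).resolve_right hq.ne'
  exact ⟨w₀, w₃, by rw [z34, z1, z2]; module⟩

end Algebra

/-- An ambient space `X ⊆ E` embedded isometrically by `lift` as the section `height = 1` of the null
cone of a quadratic space `V`, with a skew pair on `V`. -/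
structure ConeSection (E V : Type*) [NormedAddCommGroup E] [InnerProductSpace ℝ E]
    [NormedAddCommGroup V] [NormedSpace ℝ V] where
  X : Set E
  lift : E → V
  proj : V →L[ℝ] E
  height : V →L[ℝ] ℝ
  B : V →L[ℝ] V →L[ℝ] ℝ
  T₁ : V →L[ℝ] V
  T₂ : V →L[ℝ] V
  a : ℝ
  b : ℝ
  skew : IsSkewPair B T₁ T₂ a b
  contDiff_lift : ContDiff ℝ 3 lift
  null_lift : ∀ x ∈ X, B (lift x) (lift x) = 0
  height_lift : ∀ x ∈ X, height (lift x) = 1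
  proj_lift : ∀ x ∈ X, proj (lift x) = x
  proj_mem : ∀ G, B G G = 0 → height G = 1 → proj G ∈ X
  lift_proj : ∀ G, B G G = 0 → height G = 1 → lift (proj G) = G
  inner_proj : ∀ W W', height W = 0 → height W' = 0 → inner ℝ (proj W) (proj W') = B W W'
  isTangentVector_proj : ∀ x ∈ X, ∀ W, B (lift x) W = 0 → height W = 0 → B W W = 1 →
    IsTangentVector X x (proj W)
  exists_dual : ∀ (a : ℝ) (b : E) (d : ℝ), ∃ σ, ∀ x ∈ X, sphereEq a b d x = B σ (lift x)
  exists_sphereEq : ∀ σ, ∃ (a : ℝ) (b : E) (d : ℝ), ∀ x ∈ X, sphereEq a b d x = B σ (lift x)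

/-! ### The surface of a skew pair and its principal directions -/

namespace ConeSection

variable {E V : Type*} [NormedAddCommGroup E] [InnerProductSpace ℝ E]
  [NormedAddCommGroup V] [NormedSpace ℝ V] (D : ConeSection E V)

/-- The square of `T₁` at the lift of a point. -/
def sq (m : E) : ℝ := D.B (D.T₁ (D.lift m)) (D.T₁ (D.lift m))

/-- The surface where the squares of `T₁` and `T₂` are equal and positive. -/
def surface : Set E :=
  {m | m ∈ D.X ∧ D.B (D.T₂ (D.lift m)) (D.T₂ (D.lift m)) = D.sq m ∧ 0 < D.sq m}

/-- The component of `T G` in the kernel of `height`, along `G`. -/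
def tang (T : V →L[ℝ] V) (G : V) : V := T G - D.height (T G) • G

/-- The vector field on the surface induced by `T`, divided by the square root of `κ * sq`. -/
def field (T : V →L[ℝ] V) (κ : ℝ) (m : E) : E :=
  (√(κ * D.sq m))⁻¹ • D.proj (D.tang T (D.lift m))

/-- The first direction field. -/
def e₁ : E → E := D.field D.T₁ 1

/-- The second direction field. -/
def e₂ : E → E := D.field D.T₂ 1

/-- The difference of the squares of `T₁` and `T₂`. -/
def R : V →L[ℝ] V := D.T₁.comp D.T₁ - D.T₂.comp D.T₂

/-- The normal field. -/
def normal : E → E := D.field D.R (D.a + D.b)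

theorem R_apply (G : V) : D.R G = D.T₁ (D.T₁ G) - D.T₂ (D.T₂ G) := rfl

variable {D}

theorem sq_pos {m : E} (hm : m ∈ D.surface) : 0 < D.sq m := hm.2.2

theorem onCone {m : E} (hm : m ∈ D.surface) : OnCone D.B D.T₁ D.T₂ (D.sq m) (D.lift m) :=
  ⟨D.null_lift m hm.1, rfl, hm.2.1⟩

theorem height_tang {m : E} (hm : m ∈ D.X) (T : V →L[ℝ] V) :
    D.height (D.tang T (D.lift m)) = 0 := by
  simp [tang, D.height_lift m hm]

/-- `G` is null and orthogonal to `T₁ G`, `T₂ G` and `R G` (the last because the two squares agree),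
so the multiples of `G` subtracted in `tang` do not affect the products. -/
theorem inner_tang {m : E} (hm : m ∈ D.surface) :
    D.B (D.tang D.T₁ (D.lift m)) (D.tang D.T₁ (D.lift m)) = D.sq m ∧
    D.B (D.tang D.T₂ (D.lift m)) (D.tang D.T₂ (D.lift m)) = D.sq m ∧
    D.B (D.tang D.T₁ (D.lift m)) (D.tang D.T₂ (D.lift m)) = 0 ∧
    D.B (D.tang D.R (D.lift m)) (D.tang D.R (D.lift m)) = (D.a + D.b) * D.sq m ∧
    D.B (D.tang D.R (D.lift m)) (D.tang D.T₁ (D.lift m)) = 0 ∧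
    D.B (D.tang D.R (D.lift m)) (D.tang D.T₂ (D.lift m)) = 0 := by
  obtain ⟨⟨g00, g01, g02, g03, g04⟩, ⟨g10, g11, g12, g13, g14⟩, ⟨g20, g21, g22, g23, g24⟩,
    ⟨g30, g31, g32, g33, g34⟩, ⟨g40, g41, g42, g43, g44⟩⟩ := D.skew.gram (onCone hm)
  simp only [tang, R_apply, map_sub, map_smul, sub_apply,
    smul_apply, smul_eq_mul, g00, g01, g02, g03, g04, g10, g11, g12,
    g20, g22, g30, g31, g32, g33, g34, g40, g41, g42, g43, g44]
  refine ⟨?_, ?_, ?_, ?_, ?_, ?_⟩ <;> ring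

theorem inner_field {m : E} (hm : m ∈ D.X) (T T' : V →L[ℝ] V) (κ κ' : ℝ) :
    inner ℝ (D.field T κ m) (D.field T' κ' m) = (√(κ * D.sq m))⁻¹ * (√(κ' * D.sq m))⁻¹ *
      D.B (D.tang T (D.lift m)) (D.tang T' (D.lift m)) := by
  simp only [field, real_inner_smul_left, real_inner_smul_right]
  rw [D.inner_proj _ _ (height_tang hm T) (height_tang hm T')]
  ring

theorem inv_sqrt_mul_inv_sqrt_mul {x : ℝ} (hx : 0 < x) : (√x)⁻¹ * (√x)⁻¹ * x = 1 := by
  rw [← mul_inv, Real.mul_self_sqrt hx.le, inv_mul_cancel₀ hx.ne']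

theorem inner_e₁_e₁ {m : E} (hm : m ∈ D.surface) : inner ℝ (D.e₁ m) (D.e₁ m) = 1 := by
  rw [e₁, inner_field hm.1, (inner_tang hm).1, one_mul, inv_sqrt_mul_inv_sqrt_mul (sq_pos hm)]

theorem inner_e₂_e₂ {m : E} (hm : m ∈ D.surface) : inner ℝ (D.e₂ m) (D.e₂ m) = 1 := by
  rw [e₂, inner_field hm.1, (inner_tang hm).2.1, one_mul, inv_sqrt_mul_inv_sqrt_mul (sq_pos hm)]

theorem inner_e₁_e₂ {m : E} (hm : m ∈ D.surface) : inner ℝ (D.e₁ m) (D.e₂ m) = 0 := by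
  rw [e₂, e₁, inner_field hm.1, (inner_tang hm).2.2.1, mul_zero]

theorem inner_e₂_e₁ {m : E} (hm : m ∈ D.surface) : inner ℝ (D.e₂ m) (D.e₁ m) = 0 := by
  rw [real_inner_comm, inner_e₁_e₂ hm]

theorem inner_normal_normal {m : E} (hm : m ∈ D.surface) :
    inner ℝ (D.normal m) (D.normal m) = 1 := by
  rw [normal, inner_field hm.1, (inner_tang hm).2.2.2.1,
    inv_sqrt_mul_inv_sqrt_mul (mul_pos D.skew.add_pos (sq_pos hm))]

theorem inner_normal_e₁ {m : E} (hm : m ∈ D.surface) : inner ℝ (D.normal m) (D.e₁ m) = 0 := by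
  rw [normal, e₁, inner_field hm.1, (inner_tang hm).2.2.2.2.1, mul_zero]

theorem inner_normal_e₂ {m : E} (hm : m ∈ D.surface) : inner ℝ (D.normal m) (D.e₂ m) = 0 := by
  rw [normal, e₂, inner_field hm.1, (inner_tang hm).2.2.2.2.2, mul_zero]

theorem continuous_sq : Continuous D.sq := by
  have h : Continuous D.lift := D.contDiff_lift.continuous
  unfold sq
  fun_prop

theorem continuousOn_field (T : V →L[ℝ] V) {κ : ℝ} (hκ : 0 < κ) :
    ContinuousOn (D.field T κ) D.surface := by
  have h : Continuous D.lift := D.contDiff_lift.continuous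
  have hs : Continuous D.sq := continuous_sq
  unfold field tang
  refine ContinuousOn.smul (ContinuousOn.inv₀ (by fun_prop) fun m hm => ?_) (by fun_prop)
  exact (Real.sqrt_pos.2 (mul_pos hκ (sq_pos hm))).ne'

/-- Lifting a curve of `X`. -/
theorem exists_hasDerivAt_lift {γ : ℝ → E} {v : E} {t : ℝ} (hX : ∀ᶠ s in 𝓝 t, γ s ∈ D.X)
    (hγ : HasDerivAt γ v t) :
    ∃ W, HasDerivAt (fun s => D.lift (γ s)) W t ∧ D.proj W = v ∧ D.height W = 0 ∧
      D.B (D.lift (γ t)) W = 0 := by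
  have hd : HasFDerivAt D.lift (fderiv ℝ D.lift (γ t)) (γ t) :=
    (D.contDiff_lift.differentiable (by norm_num) (γ t)).hasFDerivAt
  have hW : HasDerivAt (fun s => D.lift (γ s)) (fderiv ℝ D.lift (γ t) v) t :=
    hd.comp_hasDerivAt t hγ
  refine ⟨_, hW, ?_, ?_, ?_⟩
  · refine (hasDerivAt_clm D.proj hW).unique (hγ.congr_of_eventuallyEq ?_)
    filter_upwards [hX] with s hs using D.proj_lift _ hs
  · refine eq_zero_of_hasDerivAt_of_eventually_const (k := 1) (hasDerivAt_clm D.height hW) ?_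
    filter_upwards [hX] with s hs using D.height_lift _ hs
  · have h0 := eq_zero_of_hasDerivAt_of_eventually_const (k := 0) (hasDerivAt_bilin D.B hW hW) (by
      filter_upwards [hX] with s hs using D.null_lift _ hs)
    have h1 := D.skew.symm (D.lift (γ t)) (fderiv ℝ D.lift (γ t) v)
    linarith

/-- Lifting a curve of the surface. -/
theorem exists_hasDerivAt_lift_surface {γ : ℝ → E} {v : E} {t : ℝ}
    (hM : ∀ᶠ s in 𝓝 t, γ s ∈ D.surface) (hγ : HasDerivAt γ v t) :
    ∃ w₁ w₂ : ℝ, HasDerivAt (fun s => D.lift (γ s))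
      (w₁ • D.tang D.T₁ (D.lift (γ t)) + w₂ • D.tang D.T₂ (D.lift (γ t))) t ∧
      v = w₁ • D.proj (D.tang D.T₁ (D.lift (γ t))) +
        w₂ • D.proj (D.tang D.T₂ (D.lift (γ t))) := by
  have hm : γ t ∈ D.surface := hM.self_of_nhds
  obtain ⟨W, hW, hpr, hh, h0⟩ := exists_hasDerivAt_lift (hM.mono fun s hs => hs.1) hγ
  have h1 := hasDerivAt_bilin D.B (hasDerivAt_clm D.T₁ hW) (hasDerivAt_clm D.T₁ hW)
  have h2 := hasDerivAt_bilin D.B (hasDerivAt_clm D.T₂ hW) (hasDerivAt_clm D.T₂ hW)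
  -- Differentiating the equation of the surface makes `W` orthogonal to `R G`. Being also
  -- orthogonal to `G`, it is a combination of `G`, `T₁ G`, `T₂ G`, and zero height determines the
  -- coefficient of `G`.
  have h3 := eq_zero_of_hasDerivAt_of_eventually_const (k := 0) (h1.sub h2) (by
    filter_upwards [hM] with s hs
    simp only [Pi.sub_apply]
    rw [hs.2.1, sq, sub_self])
  have h4 : D.B (D.T₁ (D.T₁ (D.lift (γ t)))) W = D.B (D.T₂ (D.T₂ (D.lift (γ t)))) W := by
    rw [D.skew.skew_fst, D.skew.skew_snd]
    rw [D.skew.symm (D.T₁ W), D.skew.symm (D.T₂ W)] at h3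
    linarith
  obtain ⟨w₀, w₁, w₂, hWeq⟩ := D.skew.exists_tangent_combination (onCone hm) (sq_pos hm) h0 h4
  have hw₀ : w₀ = -(w₁ * D.height (D.T₁ (D.lift (γ t))) +
      w₂ * D.height (D.T₂ (D.lift (γ t)))) := by
    rw [hWeq] at hh
    simp only [map_add, map_smul, D.height_lift _ hm.1, smul_eq_mul] at hh
    linarith
  have hW' : W = w₁ • D.tang D.T₁ (D.lift (γ t)) + w₂ • D.tang D.T₂ (D.lift (γ t)) := by
    rw [hWeq, hw₀, tang, tang]
    module
  exact ⟨w₁, w₂, hW' ▸ hW, by rw [← hpr, hW', map_add, map_smul, map_smul]⟩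

theorem proj_tang_T₁ {m : E} (hm : m ∈ D.surface) :
    D.proj (D.tang D.T₁ (D.lift m)) = √(D.sq m) • D.e₁ m := by
  rw [e₁, field, one_mul, smul_smul, mul_inv_cancel₀ (Real.sqrt_pos.2 (sq_pos hm)).ne', one_smul]

theorem proj_tang_T₂ {m : E} (hm : m ∈ D.surface) :
    D.proj (D.tang D.T₂ (D.lift m)) = √(D.sq m) • D.e₂ m := by
  rw [e₂, field, one_mul, smul_smul, mul_inv_cancel₀ (Real.sqrt_pos.2 (sq_pos hm)).ne', one_smul]

theorem exists_of_isTangentVector {m v : E} (hv : IsTangentVector D.surface m v) :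
    ∃ x₁ x₂ : ℝ, v = x₁ • D.e₁ m + x₂ • D.e₂ m := by
  obtain ⟨γ, h0, hM, hγ⟩ := hv
  obtain ⟨w₁, w₂, -, hw⟩ := exists_hasDerivAt_lift_surface hM hγ
  have hm : γ 0 ∈ D.surface := hM.self_of_nhds
  rw [proj_tang_T₁ hm, proj_tang_T₂ hm, smul_smul, smul_smul, h0] at hw
  exact ⟨_, _, hw⟩

/-- The curve is an orbit of the one-parameter group generated by `S = w₁ T₁ + w₂ T₂`. The group
preserves `B` and commutes with `T₁` and `T₂`, hence preserves the null cone and both squares. -/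
theorem isTangentVector_tang [CompleteSpace V] {m : E} (hm : m ∈ D.surface) (w₁ w₂ : ℝ) :
    IsTangentVector D.surface m
      (w₁ • D.proj (D.tang D.T₁ (D.lift m)) + w₂ • D.proj (D.tang D.T₂ (D.lift m))) := by
  set G := D.lift m with hG
  let S : V →L[ℝ] V := w₁ • D.T₁ + w₂ • D.T₂
  have hS : ∀ x, S x = w₁ • D.T₁ x + w₂ • D.T₂ x := fun x => rfl
  have skewS : ∀ x y, D.B (S x) y = -D.B x (S y) := fun x y => by
    simp only [hS, map_add, map_smul, add_apply,
      smul_apply, D.skew.skew_fst x, D.skew.skew_snd x, smul_eq_mul]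
    ring
  let H : ℝ → V := fun s => NormedSpace.exp (s • S) G
  have hH : ∀ s, HasDerivAt H (S (H s)) s := fun s => by
    have h := (hasDerivAt_exp_smul_const' (𝕂 := ℝ) S s).clm_apply (hasDerivAt_const s G)
    simpa using h
  have hH0 : H 0 = G := by simp [H]
  have const : ∀ T : V →L[ℝ] V, (∀ x, T (S x) = S (T x)) → ∀ s,
      D.B (T (H s)) (T (H s)) = D.B (T G) (T G) := fun T hT s => by
    have hd : ∀ s, HasDerivAt (fun s => D.B (T (H s)) (T (H s))) 0 s := fun s => by
      have h := hasDerivAt_bilin D.B (hasDerivAt_clm T (hH s)) (hasDerivAt_clm T (hH s))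
      rw [hT, skewS, neg_add_cancel] at h
      exact h
    have := is_const_of_deriv_eq_zero (fun s => (hd s).differentiableAt) (fun s => (hd s).deriv) s 0
    simpa [hH0] using this
  have null : ∀ s, D.B (H s) (H s) = 0 := fun s => by
    rw [← D.null_lift m hm.1]
    exact const (ContinuousLinearMap.id ℝ V) (fun _ => rfl) s
  have c1 := const D.T₁ fun x => by simp [hS, D.skew.fst_snd, D.skew.snd_fst]
  have c2 := const D.T₂ fun x => by simp [hS, D.skew.fst_snd, D.skew.snd_fst]
  have hh : HasDerivAt (fun s => (D.height (H s))⁻¹) (-D.height (S G)) 0 := by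
    have h := (hasDerivAt_clm D.height (hH 0)).inv (by
      rw [hH0, D.height_lift m hm.1]; exact one_ne_zero)
    rw [hH0, D.height_lift m hm.1] at h
    simp only [one_pow, div_one] at h
    exact h
  -- The orbit is rescaled to height `1`. The derivative of the factor supplies the multiple of `G`
  -- that turns `S G` into its component of height zero.
  refine ⟨fun s => D.proj ((D.height (H s))⁻¹ • H s), ?_, ?_, ?_⟩
  · simp [hH0, hG, D.height_lift m hm.1, D.proj_lift m hm.1]
  · have hcont : ∀ᶠ s in 𝓝 (0 : ℝ), D.height (H s) ≠ 0 := by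
      refine (hasDerivAt_clm D.height (hH 0)).continuousAt.eventually_ne ?_
      rw [hH0, D.height_lift m hm.1]
      exact one_ne_zero
    filter_upwards [hcont] with s hs
    have n : D.B ((D.height (H s))⁻¹ • H s) ((D.height (H s))⁻¹ • H s) = 0 := by simp [null s]
    have o : D.height ((D.height (H s))⁻¹ • H s) = 1 := by simp [hs]
    refine ⟨D.proj_mem _ n o, ?_, ?_⟩
    · rw [sq, D.lift_proj _ n o]
      simp only [map_smul, smul_apply, c1 s, c2 s]
      rw [hm.2.1, sq]
    · rw [sq, D.lift_proj _ n o]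
      simp only [map_smul, smul_apply, c1 s, smul_eq_mul]
      have := sq_pos hm
      have h2 : (D.height (H s))⁻¹ ≠ 0 := inv_ne_zero hs
      rw [sq] at this
      rw [← mul_assoc]
      exact mul_pos (mul_self_pos.2 h2) this
  · have h := hasDerivAt_clm D.proj (hh.smul (hH 0))
    rw [hH0, D.height_lift m hm.1] at h
    refine h.congr_deriv ?_
    simp only [tang, hS, map_add, map_sub, map_smul, inv_one]
    module

theorem isTangentVector_e₁ [CompleteSpace V] {m : E} (hm : m ∈ D.surface) :
    IsTangentVector D.surface m (D.e₁ m) := by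
  have h := isTangentVector_tang hm (√(1 * D.sq m))⁻¹ 0
  simpa [e₁, field] using h

theorem isTangentVector_e₂ [CompleteSpace V] {m : E} (hm : m ∈ D.surface) :
    IsTangentVector D.surface m (D.e₂ m) := by
  have h := isTangentVector_tang hm 0 (√(1 * D.sq m))⁻¹
  simpa [e₂, field] using h

/-- The principal curvatures of the surface. -/
def curvature (D : ConeSection E V) (κ : ℝ) (m : E) : ℝ :=
  (√((D.a + D.b) * D.sq m))⁻¹ * (κ + D.height (D.R (D.lift m)))

theorem curvature_lt {m : E} (hm : m ∈ D.surface) : D.curvature (-D.b) m < D.curvature D.a m := by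
  unfold curvature
  have := D.skew.add_pos
  have h2 := inv_pos.2 (Real.sqrt_pos.2 (mul_pos this (sq_pos hm)))
  exact mul_lt_mul_of_pos_left (by linarith) h2

/-- Only the component of `W` along `G` changes the square: `T₁ G` is orthogonal to `T₁² G`, and `T₁
T₂ = 0`. The logarithmic derivative of the factor is therefore the opposite of that component, which
cancels it in the velocity of `unitLift`. -/
theorem hasDerivAt_inv_sqrt_sq {γ : ℝ → E} {t w₁ w₂ κ : ℝ} (hκ : 0 < κ) (hm : γ t ∈ D.surface)
    (hW : HasDerivAt (fun s => D.lift (γ s))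
      (w₁ • D.tang D.T₁ (D.lift (γ t)) + w₂ • D.tang D.T₂ (D.lift (γ t))) t) :
    HasDerivAt (fun s => (√(κ * D.sq (γ s)))⁻¹)
      ((w₁ * D.height (D.T₁ (D.lift (γ t))) + w₂ * D.height (D.T₂ (D.lift (γ t)))) *
        (√(κ * D.sq (γ t)))⁻¹) t := by
  obtain ⟨-, ⟨g10, g11, g12, g13, g14⟩, -, -, -⟩ := D.skew.gram (onCone hm)
  have hκq := mul_pos hκ (sq_pos hm)
  set G := D.lift (γ t) with hG
  set W := w₁ • D.tang D.T₁ G + w₂ • D.tang D.T₂ G with hWdef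
  set w₀ := w₁ * D.height (D.T₁ G) + w₂ * D.height (D.T₂ G) with hw₀
  have hBW : D.B (D.T₁ G) (D.T₁ W) = -w₀ * D.sq (γ t) := by
    rw [hWdef, hw₀, tang, tang]
    simp only [map_add, map_sub, map_smul, g11, g13, D.skew.fst_snd, map_zero, smul_eq_mul]
    ring
  have hsq : HasDerivAt (fun s => D.sq (γ s)) (-2 * w₀ * D.sq (γ t)) t := by
    have h := hasDerivAt_bilin D.B (hasDerivAt_clm D.T₁ hW) (hasDerivAt_clm D.T₁ hW)
    rw [← hG, D.skew.symm (D.T₁ W), hBW] at h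
    exact h.congr_deriv (by ring)
  refine (((hsq.const_mul κ).sqrt hκq.ne').inv (Real.sqrt_pos.2 hκq).ne').congr_deriv ?_
  have h1 := (Real.sqrt_pos.2 hκq).ne'
  have h2 := (sq_pos hm).ne'
  rw [Real.sq_sqrt hκq.le]
  field_simp

/-- `R` acts on `T₁ G` by `-a` and on `T₂ G` by `b`, so the Weingarten map is diagonal in these
directions. The height of `R G` shifts both eigenvalues equally. -/
theorem hasDerivAt_normal {γ : ℝ → E} {t w₁ w₂ : ℝ} (hm : γ t ∈ D.surface)
    (hW : HasDerivAt (fun s => D.lift (γ s))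
      (w₁ • D.tang D.T₁ (D.lift (γ t)) + w₂ • D.tang D.T₂ (D.lift (γ t))) t) :
    HasDerivAt (fun s => D.normal (γ s))
      (-((D.curvature D.a (γ t) * w₁) • D.proj (D.tang D.T₁ (D.lift (γ t))) +
        (D.curvature (-D.b) (γ t) * w₂) • D.proj (D.tang D.T₂ (D.lift (γ t))))) t := by
  have hs := hasDerivAt_inv_sqrt_sq D.skew.add_pos hm hW
  have ht := hasDerivAt_clm D.proj ((hasDerivAt_clm D.R hW).sub
    ((hasDerivAt_clm D.height (hasDerivAt_clm D.R hW)).smul hW))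
  refine (hs.smul ht).congr_deriv ?_
  have hR₁ : D.R (D.T₁ (D.lift (γ t))) = -(D.a • D.T₁ (D.lift (γ t))) := by
    rw [R_apply, D.skew.fst_cube, D.skew.snd_fst, map_zero, sub_zero]
  have hR₂ : D.R (D.T₂ (D.lift (γ t))) = D.b • D.T₂ (D.lift (γ t)) := by
    rw [R_apply, D.skew.snd_cube, D.skew.fst_snd, map_zero, zero_sub, neg_neg]
  simp only [curvature, Pi.sub_apply, Pi.smul_apply', tang, map_add, map_sub, map_smul, smul_eq_mul,
    hR₁, hR₂, map_neg]
  module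

theorem isPrincipalVector_e₁ [CompleteSpace V] {m : E} (hm : m ∈ D.surface) :
    IsPrincipalVector D.surface D.normal m (D.curvature D.a m) (D.e₁ m) := by
  refine ⟨isTangentVector_e₁ hm, fun γ h0 hM hγ => ?_⟩
  obtain ⟨w₁, w₂, hW, hw⟩ := exists_hasDerivAt_lift_surface hM hγ
  have hm' : γ 0 ∈ D.surface := hM.self_of_nhds
  have h := hasDerivAt_normal hm' hW
  rw [h0, proj_tang_T₁ hm, proj_tang_T₂ hm] at h hw
  have h2 : w₂ * √(D.sq m) = 0 := by
    have := congrArg (fun x => inner ℝ x (D.e₂ m)) hw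
    simp only [inner_add_left, real_inner_smul_left, inner_e₁_e₂ hm, inner_e₂_e₂ hm] at this
    linarith
  have h3 : w₂ = 0 := (mul_eq_zero.1 h2).resolve_right (Real.sqrt_pos.2 (sq_pos hm)).ne'
  convert h using 1
  rw [h3] at hw ⊢
  nth_rewrite 1 [hw]
  module

theorem isPrincipalVector_e₂ [CompleteSpace V] {m : E} (hm : m ∈ D.surface) :
    IsPrincipalVector D.surface D.normal m (D.curvature (-D.b) m) (D.e₂ m) := by
  refine ⟨isTangentVector_e₂ hm, fun γ h0 hM hγ => ?_⟩
  obtain ⟨w₁, w₂, hW, hw⟩ := exists_hasDerivAt_lift_surface hM hγ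
  have hm' : γ 0 ∈ D.surface := hM.self_of_nhds
  have h := hasDerivAt_normal hm' hW
  rw [h0, proj_tang_T₁ hm, proj_tang_T₂ hm] at h hw
  have h2 : w₁ * √(D.sq m) = 0 := by
    have := congrArg (fun x => inner ℝ x (D.e₁ m)) hw
    simp only [inner_add_left, real_inner_smul_left, inner_e₂_e₁ hm, inner_e₁_e₁ hm] at this
    linarith
  have h3 : w₁ = 0 := (mul_eq_zero.1 h2).resolve_right (Real.sqrt_pos.2 (sq_pos hm)).ne'
  convert h using 1
  rw [h3] at hw ⊢
  nth_rewrite 1 [hw]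
  module

theorem norm_eq_one_of_inner {x : E} (h : inner ℝ x x = (1 : ℝ)) : ‖x‖ = 1 := by
  rw [norm_eq_sqrt_real_inner, h, Real.sqrt_one]

theorem B_lift_tang_R {m : E} (hm : m ∈ D.surface) :
    D.B (D.lift m) (D.tang D.R (D.lift m)) = 0 := by
  obtain ⟨⟨g00, g01, g02, g03, g04⟩, -⟩ := D.skew.gram (onCone hm)
  simp [tang, R_apply, g00, g03, g04]

theorem isTangentVector_normal {m : E} (hm : m ∈ D.surface) :
    IsTangentVector D.X m (D.normal m) := by
  rw [normal, field, ← map_smul]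
  refine D.isTangentVector_proj m hm.1 _ ?_ ?_ ?_
  · rw [map_smul, B_lift_tang_R hm, smul_zero]
  · rw [map_smul, height_tang hm.1, smul_zero]
  · simp only [map_smul, smul_apply, (inner_tang hm).2.2.2.1, smul_eq_mul]
    rw [← mul_assoc, inv_sqrt_mul_inv_sqrt_mul (mul_pos D.skew.add_pos (sq_pos hm))]

variable (D) in
theorem isPrincipalFrame [CompleteSpace V] :
    IsPrincipalFrame D.X D.surface D.normal D.e₁ D.e₂ where
  isUnitNormal :=
    { continuousOn := continuousOn_field _ D.skew.add_pos
      norm_eq_one := fun _ hm => norm_eq_one_of_inner (inner_normal_normal hm)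
      tangent_ambient := fun _ hm => isTangentVector_normal hm
      normal := fun m hm v hv => by
        obtain ⟨x₁, x₂, rfl⟩ := exists_of_isTangentVector hv
        rw [inner_add_right, real_inner_smul_right, real_inner_smul_right, inner_normal_e₁ hm,
          inner_normal_e₂ hm, mul_zero, mul_zero, add_zero] }
  continuousOn_fst := continuousOn_field _ one_pos
  continuousOn_snd := continuousOn_field _ one_pos
  norm_fst := fun _ hm => norm_eq_one_of_inner (inner_e₁_e₁ hm)
  norm_snd := fun _ hm => norm_eq_one_of_inner (inner_e₂_e₂ hm)
  inner_eq_zero := fun _ hm => inner_e₁_e₂ hm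
  principal := fun _ hm => ⟨_, _, curvature_lt hm, isPrincipalVector_e₁ hm, isPrincipalVector_e₂ hm⟩

/-- A unit normal field is the standard one up to sign. -/
theorem eq_or_eq_neg_normal [CompleteSpace V] {ν : E → E} (hν : IsUnitNormal D.X D.surface ν)
    {m : E} (hm : m ∈ D.surface) : ν m = D.normal m ∨ ν m = -D.normal m := by
  obtain ⟨γ, h0, hX, hγ⟩ := hν.tangent_ambient m hm
  obtain ⟨W, -, hpr, hh, hB⟩ := exists_hasDerivAt_lift hX hγ
  rw [h0] at hB
  have h1 := hν.normal m hm _ (isTangentVector_e₁ hm)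
  have h2 := hν.normal m hm _ (isTangentVector_e₂ hm)
  have hs := (inv_pos.2 (Real.sqrt_pos.2 (sq_pos hm))).ne'
  -- `W` is orthogonal to `G`, so orthogonality to `tang T G` is orthogonality to `T G`.
  have key : ∀ T : V →L[ℝ] V, inner ℝ (ν m) (D.field T 1 m) = 0 → D.B (T (D.lift m)) W = 0 := by
    intro T hT
    rw [← hpr, field, one_mul, real_inner_smul_right,
      D.inner_proj _ _ hh (height_tang hm.1 T)] at hT
    have h3 := (mul_eq_zero.1 hT).resolve_left hs
    rw [D.skew.symm, tang] at h3
    simpa [hB] using h3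
  obtain ⟨x, y, hxy⟩ := D.skew.exists_normal_combination (onCone hm) (sq_pos hm) hB (key _ h1)
    (key _ h2)
  rw [← D.R_apply] at hxy
  have hx : x = -(y * D.height (D.R (D.lift m))) := by
    rw [hxy] at hh
    simp only [map_add, map_smul, D.height_lift m hm.1, smul_eq_mul] at hh
    linarith
  have hpos := Real.sqrt_pos.2 (mul_pos D.skew.add_pos (sq_pos hm))
  have hν' : ν m = (y * √((D.a + D.b) * D.sq m)) • D.normal m := by
    rw [normal, field, smul_smul, mul_assoc, mul_inv_cancel₀ hpos.ne', mul_one, ← hpr, hxy, hx,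
      tang]
    simp only [map_add, map_sub, map_smul]
    module
  have hn : (y * √((D.a + D.b) * D.sq m)) ^ 2 = 1 := by
    have h3 : inner ℝ (ν m) (ν m) = (1 : ℝ) := by
      rw [real_inner_self_eq_norm_sq, hν.norm_eq_one m hm, one_pow]
    rw [hν', real_inner_smul_left, real_inner_smul_right, inner_normal_normal hm] at h3
    linarith
  rcases mul_self_eq_one_iff.1 ((pow_two _).symm.trans hn) with h | h <;> simp [hν', h]

/-- The directions of a principal frame are the standard ones up to order and sign. -/
theorem exists_frame_coordinates [CompleteSpace V] {ν X₁ X₂ : E → E}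
    (hF : IsPrincipalFrame D.X D.surface ν X₁ X₂) {m : E} (hm : m ∈ D.surface) :
    ∃ x₁ x₂ y₁ y₂ : ℝ, X₁ m = x₁ • D.e₁ m + x₂ • D.e₂ m ∧ X₂ m = y₁ • D.e₁ m + y₂ • D.e₂ m ∧
      x₁ ^ 2 + x₂ ^ 2 = 1 ∧ y₁ ^ 2 + y₂ ^ 2 = 1 ∧ x₁ * y₁ + x₂ * y₂ = 0 ∧ x₁ * x₂ = 0 := by
  obtain ⟨k, k₂, -, ⟨⟨γ, h0, hM, hγ⟩, hk⟩, ⟨hX₂, -⟩⟩ := hF.principal m hm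
  obtain ⟨y₁, y₂, hy⟩ := exists_of_isTangentVector hX₂
  obtain ⟨w₁, w₂, hW, hw⟩ := exists_hasDerivAt_lift_surface hM hγ
  have hm' : γ 0 ∈ D.surface := hM.self_of_nhds
  have hn := hasDerivAt_normal hm' hW
  rw [h0, proj_tang_T₁ hm, proj_tang_T₂ hm] at hn hw
  rw [smul_smul, smul_smul] at hw
  have hν := hk γ h0 hM hγ
  have e11 := inner_e₁_e₁ hm
  have e12 := inner_e₁_e₂ hm
  have e21 := inner_e₂_e₁ hm
  have e22 := inner_e₂_e₂ hm
  -- `ε` is the sign relating `ν` to the standard normal. It is differentiable along `γ` with square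
  -- `1`, so its derivative vanishes and both normals have the same derivative up to sign.
  set ε : ℝ → ℝ := fun s => inner ℝ (ν (γ s)) (D.normal (γ s)) with hε
  have hεd := hν.inner ℝ hn
  have hsign : ∀ᶠ s in 𝓝 (0 : ℝ), ε s * ε s = 1 ∧ D.normal (γ s) = ε s • ν (γ s) := by
    filter_upwards [hM] with s hs
    have h1 := inner_normal_normal hs
    rcases eq_or_eq_neg_normal hF.isUnitNormal hs with h | h
    · have h2 : ε s = 1 := by rw [hε]; simp only [h, h1]
      rw [h2, h]
      simp
    · have h2 : ε s = -1 := by rw [hε]; simp only [h, inner_neg_left, h1]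
      rw [h2, h]
      simp
  have hsign0 := hsign.self_of_nhds
  obtain ⟨ε', hε'⟩ : ∃ ε', HasDerivAt ε ε' 0 := ⟨_, hεd⟩
  have hz : ε' = 0 := by
    have h1 := eq_zero_of_hasDerivAt_of_eventually_const (k := 1) (hε'.mul hε')
      (hsign.mono fun s hs => hs.1)
    have h2 : ε 0 ≠ 0 := fun h => by simpa [h] using hsign0.1
    have h3 : ε 0 * ε' = 0 := by linarith
    exact (mul_eq_zero.1 h3).resolve_left h2
  have hd := (hε'.smul hν).congr_of_eventuallyEq (f₁ := fun s => D.normal (γ s))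
    (hsign.mono fun s hs => hs.2)
  have heq := hn.unique hd
  rw [hz, zero_smul, add_zero] at heq
  have hk1 : D.curvature D.a m * (w₁ * √(D.sq m)) = ε 0 * k * (w₁ * √(D.sq m)) := by
    have := congrArg (fun x => inner ℝ x (D.e₁ m)) heq
    simp only [hw, inner_add_left, real_inner_smul_left, inner_neg_left, e11, e21] at this
    linarith
  have hk2 : D.curvature (-D.b) m * (w₂ * √(D.sq m)) = ε 0 * k * (w₂ * √(D.sq m)) := by
    have := congrArg (fun x => inner ℝ x (D.e₂ m)) heq
    simp only [hw, inner_add_left, real_inner_smul_left, inner_neg_left, e12, e22] at this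
    linarith
  refine ⟨_, _, y₁, y₂, hw, hy, ?_, ?_, ?_, ?_⟩
  · have h1 : inner ℝ (X₁ m) (X₁ m) = (1 : ℝ) := by
      rw [real_inner_self_eq_norm_sq, hF.norm_fst m hm, one_pow]
    rw [hw] at h1
    simp only [inner_add_left, inner_add_right, real_inner_smul_left, real_inner_smul_right, e11,
      e12, e21, e22] at h1
    linarith
  · have h1 : inner ℝ (X₂ m) (X₂ m) = (1 : ℝ) := by
      rw [real_inner_self_eq_norm_sq, hF.norm_snd m hm, one_pow]
    rw [hy] at h1
    simp only [inner_add_left, inner_add_right, real_inner_smul_left, real_inner_smul_right, e11,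
      e12, e21, e22] at h1
    linarith
  · have h1 := hF.inner_eq_zero m hm
    rw [hw, hy] at h1
    simp only [inner_add_left, inner_add_right, real_inner_smul_left, real_inner_smul_right, e11,
      e12, e21, e22] at h1
    linarith
  -- Both coordinates nonzero would force the two distinct curvatures to equal `ε 0 * k`.
  · have h1 := curvature_lt hm
    have h2 : (D.curvature D.a m - D.curvature (-D.b) m) *
        (w₁ * √(D.sq m) * (w₂ * √(D.sq m))) = 0 := by
      linear_combination (w₂ * √(D.sq m)) * hk1 - (w₁ * √(D.sq m)) * hk2
    exact (mul_eq_zero.1 h2).resolve_left (by linarith)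

end ConeSection

theorem differentiable_sphereEq {E : Type*} [NormedAddCommGroup E] [InnerProductSpace ℝ E]
    (a : ℝ) (b : E) (d : ℝ) : Differentiable ℝ (sphereEq a b d) := by
  unfold sphereEq
  exact (((contDiff_norm_sq ℝ (n := 1)).differentiable (by norm_num)).const_mul a).add
    ((innerSL ℝ b).differentiable) |>.add_const d

/-! ### Tangent and osculating spheres read in the quadratic space -/

namespace ConeSection

variable {E V : Type*} [NormedAddCommGroup E] [InnerProductSpace ℝ E]
  [NormedAddCommGroup V] [NormedSpace ℝ V] {D : ConeSection E V}

theorem fderiv_sphereEq_eq {a : ℝ} {b : E} {d : ℝ} {σ : V}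
    (hσ : ∀ x ∈ D.X, sphereEq a b d x = D.B σ (D.lift x)) {γ : ℝ → E} {w : E} {W : V} {t : ℝ}
    (hX : ∀ᶠ s in 𝓝 t, γ s ∈ D.X) (hγ : HasDerivAt γ w t)
    (hW : HasDerivAt (fun s => D.lift (γ s)) W t) :
    fderiv ℝ (sphereEq a b d) (γ t) w = D.B σ W := by
  have h1 := (differentiable_sphereEq a b d (γ t)).hasFDerivAt.comp_hasDerivAt t hγ
  refine h1.unique ((hasDerivAt_clm (D.B σ) hW).congr_of_eventuallyEq ?_)
  filter_upwards [hX] with s hs using hσ _ hs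

/-- Vectors tangent to the ambient space lift to the orthogonal of `G`, spanned by `G`, `T₁ G`, `T₂
G`, `R G`. The three equations express incidence and tangency; the inequality says that the
differential is nonzero in the one remaining direction. -/
theorem isTangentSphere_iff [CompleteSpace V] {a : ℝ} {b : E} {d : ℝ} {σ : V}
    (hσ : ∀ x ∈ D.X, sphereEq a b d x = D.B σ (D.lift x)) {m : E} (hm : m ∈ D.surface) :
    IsTangentSphere D.X D.surface m a b d ↔
      D.B σ (D.lift m) = 0 ∧ D.B σ (D.T₁ (D.lift m)) = 0 ∧ D.B σ (D.T₂ (D.lift m)) = 0 ∧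
        D.B σ (D.R (D.lift m)) ≠ 0 := by
  constructor
  · rintro ⟨h0, ⟨w, ⟨γ, hγ0, hX, hγ⟩, hw⟩, hv⟩
    rw [hσ m hm.1] at h0
    have key : ∀ w₁ w₂ : ℝ, w₁ * D.B σ (D.T₁ (D.lift m)) + w₂ * D.B σ (D.T₂ (D.lift m)) = 0 := by
      intro w₁ w₂
      have ht := isTangentVector_tang hm w₁ w₂
      have h1 := hv _ ht
      obtain ⟨δ, hδ0, hM, hδ⟩ := ht
      -- Only some curve with the given velocity is available here; pairing with the orthonormal
      -- directions identifies the coefficients of its lift with `w₁, w₂`.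
      obtain ⟨w₁', w₂', hW, heq⟩ := exists_hasDerivAt_lift_surface hM hδ
      have h2 := fderiv_sphereEq_eq hσ (hM.mono fun s hs => hs.1) hδ hW
      have hp := Real.sqrt_pos.2 (sq_pos hm)
      rw [hδ0] at heq h2
      rw [h1] at h2
      rw [proj_tang_T₁ hm, proj_tang_T₂ hm] at heq
      have e1 := congrArg (fun x => inner ℝ x (D.e₁ m)) heq
      have e2 := congrArg (fun x => inner ℝ x (D.e₂ m)) heq
      simp only [inner_add_left, real_inner_smul_left, inner_e₁_e₁ hm, inner_e₂_e₁ hm, mul_zero,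
        add_zero, mul_one] at e1
      simp only [inner_add_left, real_inner_smul_left, inner_e₁_e₂ hm, inner_e₂_e₂ hm, mul_zero,
        zero_add, mul_one] at e2
      rw [mul_right_cancel₀ hp.ne' e1, mul_right_cancel₀ hp.ne' e2]
      simp only [tang, map_add, map_sub, map_smul, smul_eq_mul, h0, mul_zero, sub_zero] at h2
      exact h2.symm
    have k1 : D.B σ (D.T₁ (D.lift m)) = 0 := by simpa using key 1 0
    have k2 : D.B σ (D.T₂ (D.lift m)) = 0 := by simpa using key 0 1
    refine ⟨h0, k1, k2, fun k3 => hw ?_⟩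
    obtain ⟨W, hW, -, -, hB⟩ := exists_hasDerivAt_lift hX hγ
    have h2 := fderiv_sphereEq_eq hσ hX hγ hW
    rw [hγ0] at hB h2
    obtain ⟨⟨g00, g01, g02, g03, g04⟩, -⟩ := D.skew.gram (onCone hm)
    obtain ⟨w₀, w₁, w₂, w₃, w₄, rfl⟩ := D.skew.exists_combination (onCone hm) (sq_pos hm) W
    simp only [map_add, map_smul, smul_eq_mul, g00, g01, g02, g03, g04] at hB
    have z34 : w₄ = -w₃ := by
      have : (w₃ + w₄) * D.sq m = 0 := by linarith
      linarith [(mul_eq_zero.1 this).resolve_right (sq_pos hm).ne']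
    rw [R_apply, map_sub] at k3
    rw [h2]
    simp only [map_add, map_smul, smul_eq_mul, h0, k1, k2, z34]
    linear_combination w₃ * k3
  · rintro ⟨h0, h1, h2, h3⟩
    refine ⟨by rw [hσ m hm.1, h0], ?_, ?_⟩
    · have ht := isTangentVector_normal hm
      refine ⟨_, ht, ?_⟩
      obtain ⟨γ, hγ0, hX, hγ⟩ := ht
      obtain ⟨W, hW, hpr, hh, hB⟩ := exists_hasDerivAt_lift hX hγ
      have h4 := fderiv_sphereEq_eq hσ hX hγ hW
      rw [hγ0] at h4 hB
      rw [h4]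
      intro h5
      obtain ⟨⟨g00, g01, g02, g03, g04⟩, -, -, ⟨g30, g31, g32, g33, g34⟩,
        ⟨g40, g41, g42, g43, g44⟩⟩ := D.skew.gram (onCone hm)
      obtain ⟨w₀, w₁, w₂, w₃, w₄, rfl⟩ := D.skew.exists_combination (onCone hm) (sq_pos hm) W
      simp only [map_add, map_smul, smul_eq_mul, g00, g01, g02, g03, g04] at hB
      have z34 : w₄ = -w₃ := by
        have : (w₃ + w₄) * D.sq m = 0 := by linarith
        linarith [(mul_eq_zero.1 this).resolve_right (sq_pos hm).ne']
      simp only [map_add, map_smul, smul_eq_mul, h0, h1, h2, z34] at h5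
      have z3 : w₃ = 0 := by
        rw [R_apply, map_sub] at h3
        refine (mul_eq_zero.1 (?_ : w₃ * _ = 0)).resolve_right h3
        linear_combination h5
      have h6 := D.inner_proj _ (D.tang D.R (D.lift m)) hh (height_tang hm.1 _)
      rw [hpr] at h6
      -- With `w₃ = 0`, the lift of the normal is a combination of `G`, `T₁ G`, `T₂ G`, all
      -- orthogonal to `tang R G`; the unit normal would be orthogonal to itself.
      have h7 : inner ℝ (D.normal m) (D.normal m) = (0 : ℝ) := by
        conv_lhs => enter [3]; rw [normal, field]
        rw [real_inner_smul_right, h6, z34, z3]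
        have i1 : D.B (D.T₁ (D.lift m)) (D.R (D.lift m)) = 0 := by
          obtain ⟨-, ⟨g10, g11, g12, g13, g14⟩, -⟩ := D.skew.gram (onCone hm)
          rw [R_apply, map_sub, g13, g14, sub_zero]
        have i2 : D.B (D.T₂ (D.lift m)) (D.R (D.lift m)) = 0 := by
          obtain ⟨-, -, ⟨g20, g21, g22, g23, g24⟩, -⟩ := D.skew.gram (onCone hm)
          rw [R_apply, map_sub, g23, g24, sub_zero]
        have i0 : D.B (D.lift m) (D.R (D.lift m)) = 0 := by
          rw [R_apply, map_sub, g03, g04, sub_self]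
        have i3 : D.B (D.T₁ (D.lift m)) (D.lift m) = 0 := by rw [D.skew.symm, g01]
        have i4 : D.B (D.T₂ (D.lift m)) (D.lift m) = 0 := by rw [D.skew.symm, g02]
        simp [tang, i0, i1, i2, i3, i4, g00]
      rw [inner_normal_normal hm] at h7
      exact one_ne_zero h7
    · rintro v ⟨γ, hγ0, hM, hγ⟩
      obtain ⟨w₁, w₂, hW, -⟩ := exists_hasDerivAt_lift_surface hM hγ
      have h4 := fderiv_sphereEq_eq hσ (hM.mono fun s hs => hs.1) hγ hW
      rw [hγ0] at h4
      rw [h4]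
      simp [tang, h0, h1, h2]

/-- The lift of a point of the surface, normalized so that the squares of `T₁` and `T₂` are `1`. -/
def unitLift (D : ConeSection E V) (m : E) : V := (√(1 * D.sq m))⁻¹ • D.lift m

theorem onCone_unitLift {m : E} (hm : m ∈ D.surface) :
    OnCone D.B D.T₁ D.T₂ 1 (D.unitLift m) := by
  have h := onCone hm
  have hs := inv_sqrt_mul_inv_sqrt_mul (sq_pos hm)
  constructor
  · simp [unitLift, h.null]
  · simp only [unitLift, map_smul, smul_apply, h.fst, one_mul, smul_eq_mul]
    rw [← mul_assoc, hs]
  · simp only [unitLift, map_smul, smul_apply, h.snd, one_mul, smul_eq_mul]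
    rw [← mul_assoc, hs]

theorem contDiff_sq : ContDiff ℝ 3 D.sq := by
  unfold sq
  have h : ContDiff ℝ 3 fun m => D.T₁ (D.lift m) := D.T₁.contDiff.comp D.contDiff_lift
  exact (D.B.contDiff.comp h).clm_apply h

variable {I : Set ℝ} {c : ℝ → E}

theorem contDiffOn_sqrt_sq (hc : IsRegularCurveOn D.surface I c) :
    ContDiffOn ℝ 3 (fun t => √(1 * D.sq (c t))) I := by
  refine ContDiffOn.sqrt (contDiffOn_const.mul (contDiff_sq.comp_contDiffOn hc.contDiffOn))
    fun t ht => ?_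
  simpa using (sq_pos (hc.mapsTo ht)).ne'

theorem sqrt_sq_ne_zero (hc : IsRegularCurveOn D.surface I c) {t : ℝ} (ht : t ∈ I) :
    √(1 * D.sq (c t)) ≠ 0 := by
  rw [one_mul]
  exact (Real.sqrt_pos.2 (sq_pos (hc.mapsTo ht))).ne'

theorem contDiffOn_unitLift (hc : IsRegularCurveOn D.surface I c) :
    ContDiffOn ℝ 3 (fun t => D.unitLift (c t)) I :=
  ((contDiffOn_sqrt_sq hc).inv fun _ ht => sqrt_sq_ne_zero hc ht).smul
    (D.contDiff_lift.comp_contDiffOn hc.contDiffOn)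

theorem hasDerivAt_curve {M : Set E} (hc : IsRegularCurveOn M I c) {t : ℝ}
    (ht : t ∈ I) : HasDerivAt c (deriv c t) t :=
  ((hc.contDiffOn.contDiffAt (hc.isOpen.mem_nhds ht)).differentiableAt (by norm_num)).hasDerivAt

/-- The components of the velocity of a curve on the surface. -/
structure IsVelocity (D : ConeSection E V) (I : Set ℝ) (c : ℝ → E) (u v : ℝ → ℝ) : Prop where
  contDiffOn_fst : ContDiffOn ℝ 2 u I
  contDiffOn_snd : ContDiffOn ℝ 2 v I
  hasDerivAt : ∀ t ∈ I, HasDerivAt (fun t => D.unitLift (c t))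
    (u t • D.T₁ (D.unitLift (c t)) + v t • D.T₂ (D.unitLift (c t))) t
  deriv_eq : ∀ t ∈ I, deriv c t =
    √(D.sq (c t)) • (u t • D.e₁ (c t) + v t • D.e₂ (c t))

/-- `T₁ F` and `T₂ F` are orthonormal for the rescaled lift `F`, so the coefficients are the
products `B F' (T₁ F)` and `B F' (T₂ F)`. These formulas show that they are of class `C²`. -/
theorem exists_isVelocity (hc : IsRegularCurveOn D.surface I c) :
    ∃ u v : ℝ → ℝ, D.IsVelocity I c u v := by
  have hF := contDiffOn_unitLift hc
  have hF' : ContDiffOn ℝ 2 (deriv fun t => D.unitLift (c t)) I :=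
    hF.deriv_of_isOpen hc.isOpen (by norm_num)
  have hF2 : ContDiffOn ℝ 2 (fun t => D.unitLift (c t)) I := hF.of_le (by norm_num)
  have key : ∀ t ∈ I, ∃ w₁ w₂ : ℝ, HasDerivAt (fun t => D.unitLift (c t))
      (w₁ • D.T₁ (D.unitLift (c t)) + w₂ • D.T₂ (D.unitLift (c t))) t ∧ deriv c t =
      √(D.sq (c t)) • (w₁ • D.e₁ (c t) + w₂ • D.e₂ (c t)) := by
    intro t ht
    have hm := hc.mapsTo ht
    obtain ⟨w₁, w₂, hW, hw⟩ := exists_hasDerivAt_lift_surface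
      (by filter_upwards [hc.isOpen.mem_nhds ht] with s hs using hc.mapsTo hs)
      (hasDerivAt_curve hc ht)
    refine ⟨w₁, w₂, ?_, ?_⟩
    · refine ((hasDerivAt_inv_sqrt_sq one_pos hm hW).smul hW).congr_deriv ?_
      simp only [unitLift, tang, map_smul]
      module
    · rw [hw, proj_tang_T₁ hm, proj_tang_T₂ hm]
      module
  have coef : ∀ t ∈ I, ∀ w₁ w₂ : ℝ, HasDerivAt (fun t => D.unitLift (c t))
      (w₁ • D.T₁ (D.unitLift (c t)) + w₂ • D.T₂ (D.unitLift (c t))) t →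
      D.B (deriv (fun t => D.unitLift (c t)) t) (D.T₁ (D.unitLift (c t))) = w₁ ∧
      D.B (deriv (fun t => D.unitLift (c t)) t) (D.T₂ (D.unitLift (c t))) = w₂ := by
    intro t ht w₁ w₂ h
    obtain ⟨-, ⟨g10, g11, g12, g13, g14⟩, ⟨g20, g21, g22, g23, g24⟩, -⟩ :=
      D.skew.gram (onCone_unitLift (hc.mapsTo ht))
    rw [h.deriv]
    simp [g11, g12, g21, g22]
  refine ⟨fun t => D.B (deriv (fun t => D.unitLift (c t)) t) (D.T₁ (D.unitLift (c t))),
    fun t => D.B (deriv (fun t => D.unitLift (c t)) t) (D.T₂ (D.unitLift (c t))), ?_, ?_, ?_, ?_⟩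
  · exact (D.B.contDiff.comp_contDiffOn hF').clm_apply (D.T₁.contDiff.comp_contDiffOn hF2)
  · exact (D.B.contDiff.comp_contDiffOn hF').clm_apply (D.T₂.contDiff.comp_contDiffOn hF2)
  · intro t ht
    obtain ⟨w₁, w₂, h, -⟩ := key t ht
    obtain ⟨h1, h2⟩ := coef t ht w₁ w₂ h
    simp only [h1, h2]
    exact h
  · intro t ht
    obtain ⟨w₁, w₂, h, h'⟩ := key t ht
    obtain ⟨h1, h2⟩ := coef t ht w₁ w₂ h
    simp only [h1, h2]
    exact h'

/-- Along the curve the two functions differ by a nonvanishing factor of class `C³`, in either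
direction. -/
theorem isOsculatingSphere_iff (hc : IsRegularCurveOn D.surface I c) {a : ℝ} {b : E} {d : ℝ} {σ : V}
    (hσ : ∀ x ∈ D.X, sphereEq a b d x = D.B σ (D.lift x)) {t : ℝ} (ht : t ∈ I) :
    IsOsculatingSphere c t a b d ↔
      ∀ j ≤ 3, iteratedDeriv j (fun s => D.B σ (D.unitLift (c s))) t = 0 := by
  have hI := hc.isOpen.mem_nhds ht
  have h1 : ContDiffAt ℝ 3 (fun s => √(1 * D.sq (c s))) t :=
    (contDiffOn_sqrt_sq hc).contDiffAt hI
  have h2 : ContDiffAt ℝ 3 (fun s => (√(1 * D.sq (c s)))⁻¹) t := h1.inv (sqrt_sq_ne_zero hc ht)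
  have h3 : ContDiffAt ℝ 3 (fun s => D.B σ (D.unitLift (c s))) t :=
    (D.B σ).contDiff.contDiffAt.comp t ((contDiffOn_unitLift hc).contDiffAt hI)
  have h4 : ContDiffAt ℝ 3 (fun s => D.B σ (D.lift (c s))) t :=
    (D.B σ).contDiff.contDiffAt.comp t
      ((D.contDiff_lift.comp_contDiffOn hc.contDiffOn).contDiffAt hI)
  have e1 : (fun s => sphereEq a b d (c s)) =ᶠ[𝓝 t] fun s => D.B σ (D.lift (c s)) := by
    filter_upwards [hI] with s hs using hσ _ (hc.mapsTo hs).1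
  have e2 : (fun s => D.B σ (D.lift (c s))) =ᶠ[𝓝 t]
      fun s => √(1 * D.sq (c s)) * D.B σ (D.unitLift (c s)) := by
    filter_upwards [hI] with s hs
    rw [unitLift, map_smul, smul_eq_mul, mul_inv_cancel_left₀ (sqrt_sq_ne_zero hc hs)]
  constructor
  · intro h j hj
    have h5 : (fun s => D.B σ (D.unitLift (c s))) =
        fun s => (√(1 * D.sq (c s)))⁻¹ * D.B σ (D.lift (c s)) := by
      funext s
      rw [unitLift, map_smul, smul_eq_mul]
    rw [h5]
    refine iteratedDeriv_mul_eq_zero h4 h2 (fun i hi => ?_) j hj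
    rw [← e1.iteratedDeriv_eq]
    exact h i hi
  · intro h j hj
    rw [e1.iteratedDeriv_eq, e2.iteratedDeriv_eq]
    exact iteratedDeriv_mul_eq_zero h3 h1 h j hj

/-- Mixed terms vanish since `T₁ T₂ = T₂ T₁ = 0`, and cubes reduce to `T₁`, `T₂`. At a point of
tangency this kills every term in `B σ (T₁ F)` and `B σ (T₂ F)`, including those that carry second
derivatives of `u` and `v`. -/
theorem iteratedDeriv_B_unitLift (hc : IsRegularCurveOn D.surface I c) {u v : ℝ → ℝ}
    (huv : D.IsVelocity I c u v) (σ : V) {t : ℝ} (ht : t ∈ I)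
    (h1 : D.B σ (D.T₁ (D.unitLift (c t))) = 0) (h2 : D.B σ (D.T₂ (D.unitLift (c t))) = 0) :
    iteratedDeriv 1 (fun s => D.B σ (D.unitLift (c s))) t = 0 ∧
    iteratedDeriv 2 (fun s => D.B σ (D.unitLift (c s))) t =
      u t ^ 2 * D.B σ (D.T₁ (D.T₁ (D.unitLift (c t)))) +
        v t ^ 2 * D.B σ (D.T₂ (D.T₂ (D.unitLift (c t)))) ∧
    iteratedDeriv 3 (fun s => D.B σ (D.unitLift (c s))) t =
      3 * (u t * deriv u t * D.B σ (D.T₁ (D.T₁ (D.unitLift (c t)))) +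
        v t * deriv v t * D.B σ (D.T₂ (D.T₂ (D.unitLift (c t))))) := by
  have hI := hc.isOpen
  have du : ∀ t ∈ I, HasDerivAt u (deriv u t) t := fun t ht =>
    ((huv.contDiffOn_fst.contDiffAt (hI.mem_nhds ht)).differentiableAt (by norm_num)).hasDerivAt
  have dv : ∀ t ∈ I, HasDerivAt v (deriv v t) t := fun t ht =>
    ((huv.contDiffOn_snd.contDiffAt (hI.mem_nhds ht)).differentiableAt (by norm_num)).hasDerivAt
  have ddu : ∀ t ∈ I, HasDerivAt (deriv u) (deriv (deriv u) t) t := fun t ht =>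
    (((huv.contDiffOn_fst.deriv_of_isOpen (m := 1) hI (by norm_num)).contDiffAt
      (hI.mem_nhds ht)).differentiableAt (by norm_num)).hasDerivAt
  have ddv : ∀ t ∈ I, HasDerivAt (deriv v) (deriv (deriv v) t) t := fun t ht =>
    (((huv.contDiffOn_snd.deriv_of_isOpen (m := 1) hI (by norm_num)).contDiffAt
      (hI.mem_nhds ht)).differentiableAt (by norm_num)).hasDerivAt
  set F : ℝ → V := fun t => D.unitLift (c t) with hF
  have d0 : ∀ t ∈ I, HasDerivAt (fun s => D.B σ (F s))
      (u t * D.B σ (D.T₁ (F t)) + v t * D.B σ (D.T₂ (F t))) t := fun t ht => by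
    simpa using hasDerivAt_clm (D.B σ) (huv.hasDerivAt t ht)
  have d1 : ∀ t ∈ I, HasDerivAt (fun s => D.B σ (D.T₁ (F s)))
      (u t * D.B σ (D.T₁ (D.T₁ (F t)))) t := fun t ht => by
    simpa [D.skew.fst_snd] using hasDerivAt_clm (D.B σ) (hasDerivAt_clm D.T₁ (huv.hasDerivAt t ht))
  have d2 : ∀ t ∈ I, HasDerivAt (fun s => D.B σ (D.T₂ (F s)))
      (v t * D.B σ (D.T₂ (D.T₂ (F t)))) t := fun t ht => by
    simpa [D.skew.snd_fst] using hasDerivAt_clm (D.B σ) (hasDerivAt_clm D.T₂ (huv.hasDerivAt t ht))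
  have d3 : ∀ t ∈ I, HasDerivAt (fun s => D.B σ (D.T₁ (D.T₁ (F s))))
      (u t * -(D.a * D.B σ (D.T₁ (F t)))) t := fun t ht => by
    simpa [D.skew.fst_snd, D.skew.fst_cube] using hasDerivAt_clm (D.B σ)
      (hasDerivAt_clm D.T₁ (hasDerivAt_clm D.T₁ (huv.hasDerivAt t ht)))
  have d4 : ∀ t ∈ I, HasDerivAt (fun s => D.B σ (D.T₂ (D.T₂ (F s))))
      (v t * -(D.b * D.B σ (D.T₂ (F t)))) t := fun t ht => by
    simpa [D.skew.snd_fst, D.skew.snd_cube] using hasDerivAt_clm (D.B σ)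
      (hasDerivAt_clm D.T₂ (hasDerivAt_clm D.T₂ (huv.hasDerivAt t ht)))
  obtain ⟨r1, r2, r3⟩ := iteratedDeriv_eq_of_hasDerivAt_chain hI d0
    (fun t ht => ((du t ht).mul (d1 t ht)).add ((dv t ht).mul (d2 t ht)))
    (fun t ht => (((ddu t ht).mul (d1 t ht)).add ((du t ht).mul ((du t ht).mul (d3 t ht)))).add
      (((ddv t ht).mul (d2 t ht)).add ((dv t ht).mul ((dv t ht).mul (d4 t ht))))) ht
  refine ⟨r1.trans ?_, r2.trans ?_, r3.trans ?_⟩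
  · simp only [hF, h1, h2, mul_zero, add_zero]
  · simp only [hF, h1, h2, mul_zero, zero_add]
    ring
  · simp only [hF, Pi.mul_apply, h1, h2, mul_zero, zero_add, neg_zero]
    ring

end ConeSection

/-! ### Line fields of constant angle and maximal curves -/

section LineFields

variable {E : Type*} [NormedAddCommGroup E] [InnerProductSpace ℝ E]

/-- `(X₁, X₂)` is an orthonormal frame over `M`. -/
structure IsOrthonormalFrame (M : Set E) (X₁ X₂ : E → E) : Prop where
  fst_fst : ∀ m ∈ M, inner ℝ (X₁ m) (X₁ m) = (1 : ℝ)
  snd_snd : ∀ m ∈ M, inner ℝ (X₂ m) (X₂ m) = (1 : ℝ)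
  fst_snd : ∀ m ∈ M, inner ℝ (X₁ m) (X₂ m) = (0 : ℝ)

/-- The line field spanned by `p X₁ + q X₂`. -/
def lineField (X₁ X₂ : E → E) (p q : ℝ) (m : E) : Submodule ℝ E :=
  Submodule.span ℝ {p • X₁ m + q • X₂ m}

variable {M : Set E} {X₁ X₂ : E → E} {I : Set ℝ} {c : ℝ → E}

theorem plusField_eq (α : ℝ) : plusField X₁ X₂ α = lineField X₁ X₂ (Real.cos α) (Real.sin α) := rfl

theorem minusField_eq (α : ℝ) :
    minusField X₁ X₂ α = lineField X₁ X₂ (Real.cos α) (-Real.sin α) := by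
  funext m
  simp only [minusField, lineField, neg_smul, sub_eq_add_neg]

theorem IsOrthonormalFrame.coord_eq (hF : IsOrthonormalFrame M X₁ X₂) {m : E} (hm : m ∈ M)
    (p q : ℝ) : inner ℝ (p • X₁ m + q • X₂ m) (X₁ m) = p ∧
      inner ℝ (p • X₁ m + q • X₂ m) (X₂ m) = q := by
  have h : inner ℝ (X₂ m) (X₁ m) = (0 : ℝ) := by rw [real_inner_comm, hF.fst_snd m hm]
  simp only [inner_add_left, real_inner_smul_left, hF.fst_fst m hm, hF.snd_snd m hm,
    hF.fst_snd m hm, h, mul_one, mul_zero, add_zero, zero_add, and_self]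

/-- A curve whose velocity has the coordinates `x, y` is an arc of a leaf of one of the foliations
of constant angle if and only if the ratio of `y ^ 2` and `x ^ 2 + y ^ 2` is constant. -/
theorem exists_isArcOfLeaf_iff (hF : IsOrthonormalFrame M X₁ X₂) (hc : IsRegularCurveOn M I c)
    {x y : ℝ → ℝ} (hx : ContinuousOn x I) (hy : ContinuousOn y I)
    (hxy : ∀ t ∈ I, deriv c t = x t • X₁ (c t) + y t • X₂ (c t)) :
    (∃ α ∈ Ioc (-(Real.pi / 2)) (Real.pi / 2), IsArcOfLeaf (plusField X₁ X₂ α) M I c ∨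
      IsArcOfLeaf (minusField X₁ X₂ α) M I c) ↔
      ∃ k : ℝ, ∀ t ∈ I, y t ^ 2 = k * (x t ^ 2 + y t ^ 2) := by
  have hpos : ∀ t ∈ I, 0 < x t ^ 2 + y t ^ 2 := fun t ht => by
    have h0 := hc.deriv_ne_zero t ht
    by_contra h
    have h1 : x t = 0 := by nlinarith [sq_nonneg (x t), sq_nonneg (y t)]
    have h2 : y t = 0 := by nlinarith [sq_nonneg (x t), sq_nonneg (y t)]
    rw [hxy t ht, h1, h2] at h0
    simp at h0
  constructor
  · rintro ⟨α, -, h⟩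
    have key : ∀ q : ℝ, q ^ 2 = Real.sin α ^ 2 →
        (∀ t ∈ I, deriv c t ∈ lineField X₁ X₂ (Real.cos α) q (c t)) →
        ∀ t ∈ I, y t ^ 2 = Real.sin α ^ 2 * (x t ^ 2 + y t ^ 2) := by
      intro q hq h t ht
      obtain ⟨l, hl⟩ := Submodule.mem_span_singleton.1 (h t ht)
      rw [hxy t ht, smul_add, smul_smul, smul_smul] at hl
      have h1 := hF.coord_eq (hc.mapsTo ht) (x t) (y t)
      rw [← hl] at h1
      have h2 := hF.coord_eq (hc.mapsTo ht) (l * Real.cos α) (l * q)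
      rw [← h1.1, ← h1.2, h2.1, h2.2, mul_pow, mul_pow, hq, ← mul_add, Real.cos_sq_add_sin_sq]
      ring
    rcases h with h | h
    · exact ⟨_, key _ rfl (plusField_eq (X₁ := X₁) (X₂ := X₂) α ▸ h.2)⟩
    · exact ⟨_, key _ (neg_sq _) (minusField_eq (X₁ := X₁) (X₂ := X₂) α ▸ h.2)⟩
  · rintro ⟨k, hk⟩
    have hpi := Real.pi_pos
    obtain ⟨t₀, ht₀⟩ := hc.nonempty
    have hk0 : 0 ≤ k := by
      by_contra h
      have := mul_neg_of_neg_of_pos (not_le.1 h) (hpos t₀ ht₀)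
      nlinarith [hk t₀ ht₀, sq_nonneg (y t₀)]
    have hk1 : k ≤ 1 := by
      by_contra h
      have := mul_pos (sub_pos.2 (not_le.1 h)) (hpos t₀ ht₀)
      nlinarith [hk t₀ ht₀, sq_nonneg (x t₀)]
    -- Here `k` is `sin² α`. The value `1` is separate because the slope `y / x` is then infinite.
    rcases hk1.eq_or_lt with rfl | hk1
    · refine ⟨Real.pi / 2, ⟨by linarith, le_rfl⟩, Or.inl ⟨hc, fun t ht => ?_⟩⟩
      have h1 : x t = 0 := by
        have := hk t ht
        exact pow_eq_zero_iff (two_ne_zero) |>.1 (by linarith)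
      rw [hxy t ht, h1, plusField, Real.cos_pi_div_two, Real.sin_pi_div_two]
      exact Submodule.mem_span_singleton.2 ⟨y t, by simp⟩
    · have hx0 : ∀ t ∈ I, x t ≠ 0 := fun t ht h => by
        have h1 := hk t ht
        have h2 := hpos t ht
        rw [h, zero_pow two_ne_zero, zero_add] at h1 h2
        nlinarith
      have hs0 : 0 ≤ √k := Real.sqrt_nonneg k
      have hs1 : √k < 1 := by rw [Real.sqrt_lt' one_pos]; simpa using hk1
      set α := Real.arcsin √k with hα
      have hsin : Real.sin α = √k := Real.sin_arcsin (by linarith) hs1.le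
      have hαlt : α < Real.pi / 2 := Real.arcsin_lt_pi_div_two.2 hs1
      have hα0 : 0 ≤ α := Real.arcsin_nonneg.2 hs0
      have hcos : 0 < Real.cos α := Real.cos_pos_of_mem_Ioo ⟨by linarith, hαlt⟩
      have hsq : ∀ t ∈ I, (y t / x t) ^ 2 = (Real.tan α) ^ 2 := fun t ht => by
        have h1 := hk t ht
        have h2 := hx0 t ht
        have h3 : Real.sin α ^ 2 = k := by rw [hsin, Real.sq_sqrt hk0]
        have h4 : Real.cos α ^ 2 = 1 - k := by rw [← h3, Real.cos_sq']
        rw [Real.tan_eq_sin_div_cos, div_pow, div_pow, h3, h4,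
          div_eq_div_iff (pow_ne_zero 2 h2) (by linarith)]
        linear_combination h1
      -- The slope is continuous on an interval and has constant square, so its sign is constant;
      -- the sign selects the plus or the minus foliation.
      have hor : (∀ t ∈ I, y t / x t = Real.tan α) ∨ ∀ t ∈ I, y t / x t = -Real.tan α := by
        by_cases h0 : Real.tan α = 0
        · left
          intro t ht
          have := hsq t ht
          rw [h0, zero_pow two_ne_zero] at this
          rw [h0]
          exact pow_eq_zero_iff two_ne_zero |>.1 this
        · exact hc.ordConnected.isPreconnected.eq_or_eq_neg_of_sq_eq
            (f := fun t => y t / x t) (g := fun _ => Real.tan α) (hy.div hx hx0) continuousOn_const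
            (fun t ht => hsq t ht) (fun _ => h0)
      refine ⟨α, ⟨by linarith, hαlt.le⟩, hor.imp (fun h => ⟨hc, fun t ht => ?_⟩)
        fun h => ⟨hc, fun t ht => ?_⟩⟩
      · have h1 := (div_eq_iff (hx0 t ht)).1 (h t ht)
        rw [hxy t ht, h1, plusField, Real.tan_eq_sin_div_cos]
        refine Submodule.mem_span_singleton.2 ⟨x t / Real.cos α, ?_⟩
        rw [smul_add, smul_smul, smul_smul, div_mul_cancel₀ _ hcos.ne']
        congr 2
        ring
      · have h1 := (div_eq_iff (hx0 t ht)).1 (h t ht)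
        rw [hxy t ht, h1, minusField, Real.tan_eq_sin_div_cos]
        refine Submodule.mem_span_singleton.2 ⟨x t / Real.cos α, ?_⟩
        rw [smul_sub, smul_smul, smul_smul, div_mul_cancel₀ _ hcos.ne', sub_eq_add_neg, ← neg_smul]
        congr 2
        ring

/-- Two line fields with constant coefficients that are tangent to a common curve are equal. -/
theorem lineField_le_of_mem (hF : IsOrthonormalFrame M X₁ X₂) {m v : E} (hm : m ∈ M) (hv : v ≠ 0)
    {p q p' q' : ℝ} (h : v ∈ lineField X₁ X₂ p q m) (h' : v ∈ lineField X₁ X₂ p' q' m) (m' : E) :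
    lineField X₁ X₂ p' q' m' ≤ lineField X₁ X₂ p q m' := by
  obtain ⟨l, hl⟩ := Submodule.mem_span_singleton.1 h
  obtain ⟨l', hl'⟩ := Submodule.mem_span_singleton.1 h'
  have hl0 : l' ≠ 0 := by
    rintro rfl
    rw [zero_smul] at hl'
    exact hv hl'.symm
  have heq := hl'.trans hl.symm
  rw [smul_add, smul_add, smul_smul, smul_smul, smul_smul, smul_smul] at heq
  have h1 := hF.coord_eq hm (l' * p') (l' * q')
  rw [heq] at h1
  have h2 := hF.coord_eq hm (l * p) (l * q)
  have e1 : l' * p' = l * p := by rw [← h1.1, h2.1]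
  have e2 : l' * q' = l * q := by rw [← h1.2, h2.2]
  refine (Submodule.span_singleton_le_iff_mem _ _).2 (Submodule.mem_span_singleton.2 ⟨l'⁻¹ * l, ?_⟩)
  rw [smul_add, smul_smul, smul_smul, mul_assoc, mul_assoc, ← e1, ← e2, inv_mul_cancel_left₀ hl0,
    inv_mul_cancel_left₀ hl0]

/-- An extension in the class `Q` follows some line field with constant coefficients. On the
original arc this field contains the velocity, so it is the original field everywhere and maximality
of the leaf applies. -/
theorem isMaximalTrace_of_lineField {Q : Set ℝ → (ℝ → E) → Prop}
    (hF : IsOrthonormalFrame M X₁ X₂) {p q : ℝ}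
    (hQ : ∀ I c, IsArcOfLeaf (lineField X₁ X₂ p q) M I c → Q I c)
    (hQ' : ∀ I c, Q I c → ∃ p' q' : ℝ, IsArcOfLeaf (lineField X₁ X₂ p' q') M I c) {L : Set E}
    (hL : IsLeaf (lineField X₁ X₂ p q) M L) : IsMaximalTrace Q L := by
  obtain ⟨I, c, hc, hunit, hmax, rfl⟩ := hL
  refine ⟨I, c, hQ I c hc, hunit, fun J c' hc' hunit' hIJ heq => ?_, rfl⟩
  obtain ⟨p', q', harc⟩ := hQ' J c' hc'
  refine hmax J c' ⟨harc.1, fun t ht => ?_⟩ hunit' hIJ heq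
  obtain ⟨t₀, ht₀⟩ := hc.1.nonempty
  have hd : deriv c' t₀ = deriv c t₀ := Filter.EventuallyEq.deriv_eq (by
    filter_upwards [hc.1.isOpen.mem_nhds ht₀] with s hs using heq hs)
  have h1 := harc.2 t₀ (hIJ ht₀)
  rw [hd, heq ht₀] at h1
  exact lineField_le_of_mem hF (hc.1.mapsTo ht₀) (hc.1.deriv_ne_zero t₀ ht₀) (hc.2 t₀ ht₀) h1 _
    (harc.2 t ht)

/-- Maximality is inherited by a smaller class of competitors. -/
theorem isMaximalTrace_mono {Q Q' : Set ℝ → (ℝ → E) → Prop} (h : ∀ I c, Q' I c → Q I c) {L : Set E}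
    {I : Set ℝ} {c : ℝ → E} (hc : Q' I c) (hunit : ∀ t ∈ I, ‖deriv c t‖ = 1)
    (hmax : ∀ (J : Set ℝ) (c' : ℝ → E), Q J c' → (∀ t ∈ J, ‖deriv c' t‖ = 1) →
      I ⊆ J → EqOn c' c I → J = I) (hL : L = c '' I) : IsMaximalTrace Q' L :=
  ⟨I, c, hc, hunit, fun J c' hc' => hmax J c' (h J c' hc'), hL⟩

theorem isMaximalTrace_iff_exists_isLeaf {Q : Set ℝ → (ℝ → E) → Prop}
    (hF : IsOrthonormalFrame M X₁ X₂)
    (hQ : ∀ I c, Q I c ↔ ∃ α ∈ Ioc (-(Real.pi / 2)) (Real.pi / 2),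
      IsArcOfLeaf (plusField X₁ X₂ α) M I c ∨ IsArcOfLeaf (minusField X₁ X₂ α) M I c) (L : Set E) :
    IsMaximalTrace Q L ↔ ∃ α ∈ Ioc (-(Real.pi / 2)) (Real.pi / 2),
      IsLeaf (plusField X₁ X₂ α) M L ∨ IsLeaf (minusField X₁ X₂ α) M L := by
  have hplus : ∀ α ∈ Ioc (-(Real.pi / 2)) (Real.pi / 2), ∀ I c,
      IsArcOfLeaf (plusField X₁ X₂ α) M I c → Q I c := fun α hα I c h =>
    (hQ I c).2 ⟨α, hα, Or.inl h⟩
  have hminus : ∀ α ∈ Ioc (-(Real.pi / 2)) (Real.pi / 2), ∀ I c,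
      IsArcOfLeaf (minusField X₁ X₂ α) M I c → Q I c := fun α hα I c h =>
    (hQ I c).2 ⟨α, hα, Or.inr h⟩
  have hline : ∀ I c, Q I c → ∃ p' q' : ℝ, IsArcOfLeaf (lineField X₁ X₂ p' q') M I c := by
    intro I c h
    obtain ⟨α, -, h | h⟩ := (hQ I c).1 h
    · exact ⟨_, _, plusField_eq (X₁ := X₁) (X₂ := X₂) α ▸ h⟩
    · exact ⟨_, _, minusField_eq (X₁ := X₁) (X₂ := X₂) α ▸ h⟩
  constructor
  · rintro ⟨I, c, hc, hunit, hmax, hL⟩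
    obtain ⟨α, hα, h | h⟩ := (hQ I c).1 hc
    · exact ⟨α, hα, Or.inl (isMaximalTrace_mono (hplus α hα) h hunit hmax hL)⟩
    · exact ⟨α, hα, Or.inr (isMaximalTrace_mono (hminus α hα) h hunit hmax hL)⟩
  · rintro ⟨α, hα, h | h⟩
    · rw [plusField_eq] at h
      exact isMaximalTrace_of_lineField hF (hplus α hα) hline h
    · have hm := hminus α hα
      rw [minusField_eq] at h hm
      exact isMaximalTrace_of_lineField hF hm hline h

end LineFields

theorem IsPrincipalFrame.isOrthonormalFrame {E : Type*} [NormedAddCommGroup E]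
    [InnerProductSpace ℝ E] {X M : Set E} {ν X₁ X₂ : E → E} (h : IsPrincipalFrame X M ν X₁ X₂) :
    IsOrthonormalFrame M X₁ X₂ where
  fst_fst m hm := by rw [real_inner_self_eq_norm_sq, h.norm_fst m hm, one_pow]
  snd_snd m hm := by rw [real_inner_self_eq_norm_sq, h.norm_snd m hm, one_pow]
  fst_snd := h.inner_eq_zero

/-! ### The equation of Darboux curves -/

namespace ConeSection

variable {E V : Type*} [NormedAddCommGroup E] [InnerProductSpace ℝ E]
  [NormedAddCommGroup V] [NormedSpace ℝ V] {D : ConeSection E V} {I : Set ℝ} {c : ℝ → E}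
  {u v : ℝ → ℝ}

theorem sq_add_sq_pos (hc : IsRegularCurveOn D.surface I c) (huv : D.IsVelocity I c u v) {t : ℝ}
    (ht : t ∈ I) : 0 < u t ^ 2 + v t ^ 2 := by
  by_contra h
  have h1 : u t = 0 := by nlinarith [sq_nonneg (u t), sq_nonneg (v t)]
  have h2 : v t = 0 := by nlinarith [sq_nonneg (u t), sq_nonneg (v t)]
  refine hc.deriv_ne_zero t ht ?_
  rw [huv.deriv_eq t ht, h1, h2]
  simp

/-- For a tangent `σ`, contact of order three is a homogeneous linear system in `p = B σ (T₁² F)`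
and `r = B σ (T₂² F)`, with determinant `u v (u v' - v u')` up to a constant. A nonzero determinant
gives `p = r = 0`, which is not a regular sphere. Otherwise `(v², -u²)` is a solution with `p - r =
u² + v² > 0`. -/
theorem exists_tangent_osculating_iff [CompleteSpace V] (hc : IsRegularCurveOn D.surface I c)
    (huv : D.IsVelocity I c u v) {t : ℝ} (ht : t ∈ I) :
    (∃ (a : ℝ) (b : E) (d : ℝ),
      IsTangentSphere D.X D.surface (c t) a b d ∧ IsOsculatingSphere c t a b d) ↔
    u t * v t * (u t * deriv v t - v t * deriv u t) = 0 := by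
  have hm := hc.mapsTo ht
  have hne := sqrt_sq_ne_zero hc ht
  have hlift : D.lift (c t) = √(1 * D.sq (c t)) • D.unitLift (c t) := by
    rw [unitLift, smul_smul, mul_inv_cancel₀ hne, one_smul]
  have hsphere : ∀ σ : V, (D.B σ (D.lift (c t)) = 0 ∧ D.B σ (D.T₁ (D.lift (c t))) = 0 ∧
      D.B σ (D.T₂ (D.lift (c t))) = 0 ∧ D.B σ (D.R (D.lift (c t))) ≠ 0) ↔
      (D.B σ (D.unitLift (c t)) = 0 ∧ D.B σ (D.T₁ (D.unitLift (c t))) = 0 ∧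
      D.B σ (D.T₂ (D.unitLift (c t))) = 0 ∧ D.B σ (D.R (D.unitLift (c t))) ≠ 0) := by
    intro σ
    rw [hlift]
    simp only [map_smul, smul_eq_mul, mul_eq_zero, hne, false_or, ne_eq]
  constructor
  · rintro ⟨a, b, d, htan, hosc⟩
    obtain ⟨σ, hσ⟩ := D.exists_dual a b d
    rw [isTangentSphere_iff hσ hm, hsphere] at htan
    rw [isOsculatingSphere_iff hc hσ ht] at hosc
    obtain ⟨h0, h1, h2, h3⟩ := htan
    obtain ⟨-, j2, j3⟩ := iteratedDeriv_B_unitLift hc huv σ ht h1 h2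
    rw [hosc 2 (by norm_num)] at j2
    rw [hosc 3 le_rfl] at j3
    by_contra hdet
    refine h3 ?_
    set p := D.B σ (D.T₁ (D.T₁ (D.unitLift (c t))))
    set r := D.B σ (D.T₂ (D.T₂ (D.unitLift (c t))))
    have hu : u t ≠ 0 := fun h => hdet (by simp [h])
    have hv : v t ≠ 0 := fun h => hdet (by simp [h])
    have hd : u t * deriv v t - v t * deriv u t ≠ 0 := fun h => hdet (by simp [h])
    have hp : p = 0 := by
      have : p * (u t * (u t * deriv v t - v t * deriv u t)) = 0 := by
        linear_combination (-deriv v t) * j2 + (v t / 3) * j3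
      exact (mul_eq_zero.1 this).resolve_right (mul_ne_zero hu hd)
    have hr : r = 0 := by
      have : r * (v t * (u t * deriv v t - v t * deriv u t)) = 0 := by
        linear_combination (deriv u t) * j2 - (u t / 3) * j3
      exact (mul_eq_zero.1 this).resolve_right (mul_ne_zero hv hd)
    rw [R_apply, map_sub]
    exact sub_eq_zero.2 (hp.trans hr.symm)
  · intro hdet
    have huv0 : u t ^ 2 + v t ^ 2 ≠ 0 := (sq_add_sq_pos hc huv ht).ne'
    have hab := D.skew.add_pos.ne'
    obtain ⟨⟨g00, g01, g02, g03, g04⟩, -, -, ⟨g30, g31, g32, g33, g34⟩,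
      ⟨g40, g41, g42, g43, g44⟩⟩ := D.skew.gram (onCone_unitLift hm)
    -- Solves `-x + a y = v²`, `-x - b y = -u²` for the coefficients of `σ = x F + y R F`.
    set y := (u t ^ 2 + v t ^ 2) / (D.a + D.b) with hy
    have hy' : y * (D.a + D.b) = u t ^ 2 + v t ^ 2 := div_mul_cancel₀ _ hab
    set σ := (y * D.a - v t ^ 2) • D.unitLift (c t) + y • D.R (D.unitLift (c t)) with hσdef
    have h0 : D.B σ (D.unitLift (c t)) = 0 := by simp [σ, R_apply, g00, g30, g40]
    have h1 : D.B σ (D.T₁ (D.unitLift (c t))) = 0 := by simp [σ, R_apply, g01, g31, g41]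
    have h2 : D.B σ (D.T₂ (D.unitLift (c t))) = 0 := by simp [σ, R_apply, g02, g32, g42]
    have hp : D.B σ (D.T₁ (D.T₁ (D.unitLift (c t)))) = v t ^ 2 := by
      simp [σ, R_apply, g03, g33, g43]
    have hr : D.B σ (D.T₂ (D.T₂ (D.unitLift (c t)))) = -u t ^ 2 := by
      simp only [σ, R_apply, map_add, map_smul, map_sub, add_apply, smul_apply, sub_apply, g04, g34,
        g44, smul_eq_mul]
      linear_combination -hy'
    obtain ⟨a, b, d, hσ⟩ := D.exists_sphereEq σ
    obtain ⟨j1, j2, j3⟩ := iteratedDeriv_B_unitLift hc huv σ ht h1 h2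
    refine ⟨a, b, d, ?_, ?_⟩
    · rw [isTangentSphere_iff hσ hm, hsphere]
      refine ⟨h0, h1, h2, ?_⟩
      rw [D.R_apply, map_sub, hp, hr]
      intro h
      exact huv0 (by linarith)
    · rw [isOsculatingSphere_iff hc hσ ht]
      intro j hj
      interval_cases j
      · simpa using h0
      · exact j1
      · rw [j2, hp, hr]
        ring
      · rw [j3, hp, hr]
        linear_combination (-3) * hdet

/-- The determinant of the osculation system is, up to a positive factor, the derivative of this
ratio. -/
theorem isDarbouxCurve_iff_const [CompleteSpace V] (hc : IsRegularCurveOn D.surface I c)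
    (huv : D.IsVelocity I c u v) :
    IsDarbouxCurve D.X D.surface I c ↔
      ∀ s ∈ I, ∀ t ∈ I, v s ^ 2 / (u s ^ 2 + v s ^ 2) = v t ^ 2 / (u t ^ 2 + v t ^ 2) := by
  have hI := hc.isOpen
  have hd : ∀ t ∈ I, HasDerivAt (fun t => v t ^ 2 / (u t ^ 2 + v t ^ 2))
      (2 * (u t * v t * (u t * deriv v t - v t * deriv u t)) / (u t ^ 2 + v t ^ 2) ^ 2) t := by
    intro t ht
    have du : HasDerivAt u (deriv u t) t :=
      ((huv.contDiffOn_fst.contDiffAt (hI.mem_nhds ht)).differentiableAt (by norm_num)).hasDerivAt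
    have dv : HasDerivAt v (deriv v t) t :=
      ((huv.contDiffOn_snd.contDiffAt (hI.mem_nhds ht)).differentiableAt (by norm_num)).hasDerivAt
    refine ((dv.pow 2).div ((du.pow 2).add (dv.pow 2)) (sq_add_sq_pos hc huv ht).ne').congr_deriv ?_
    congr 1
    simp only [Pi.pow_apply, Pi.add_apply]
    push_cast
    ring
  have hiff : IsDarbouxCurve D.X D.surface I c ↔
      ∀ t ∈ I, u t * v t * (u t * deriv v t - v t * deriv u t) = 0 :=
    ⟨fun h t ht => (exists_tangent_osculating_iff hc huv ht).1 (h.2 t ht),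
      fun h => ⟨hc, fun t ht => (exists_tangent_osculating_iff hc huv ht).2 (h t ht)⟩⟩
  rw [hiff]
  constructor
  · intro h s hs t ht
    exact hI.is_const_of_deriv_eq_zero (f := fun t => v t ^ 2 / (u t ^ 2 + v t ^ 2))
      hc.ordConnected.isPreconnected
      (fun t ht => (hd t ht).differentiableAt.differentiableWithinAt)
      (fun t ht => by simp [(hd t ht).deriv, h t ht]) hs ht
  · intro h t ht
    have h1 := eq_zero_of_hasDerivAt_of_eventually_const (hd t ht)
      (k := v t ^ 2 / (u t ^ 2 + v t ^ 2))
      (by filter_upwards [hI.mem_nhds ht] with s hs using h s hs t ht)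
    have h2 := sq_add_sq_pos hc huv ht
    rw [div_eq_zero_iff] at h1
    rcases h1 with h1 | h1
    · linarith
    · exact absurd h1 (by positivity)

/-- The given frame agrees with the standard one up to order and signs, which reversing `ν` can
change. Only symmetric functions of the squared coordinates are certain to agree. -/
theorem frame_coordinates_sq [CompleteSpace V] {ν X₁ X₂ : E → E}
    (hF : IsPrincipalFrame D.X D.surface ν X₁ X₂) {m : E} (hm : m ∈ D.surface) (u v : ℝ) :
    ∃ x y : ℝ, u • D.e₁ m + v • D.e₂ m = x • X₁ m + y • X₂ m ∧ x ^ 2 + y ^ 2 = u ^ 2 + v ^ 2 ∧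
      (x * y) ^ 2 = (u * v) ^ 2 := by
  obtain ⟨x₁, x₂, y₁, y₂, hX, hY, hx, hy, hxy, h0⟩ := exists_frame_coordinates hF hm
  refine ⟨u * x₁ + v * x₂, u * y₁ + v * y₂, ?_, ?_, ?_⟩
  -- Either the directions are exchanged (`x₁ = y₂ = 0`) or they are kept (`x₂ = y₁ = 0`).
  all_goals rcases mul_eq_zero.1 h0 with h | h
  all_goals subst h
  all_goals
    first
    | have hx' : x₂ ^ 2 = 1 := by linarith
      have hz : y₂ = 0 := by
        refine (mul_eq_zero.1 (?_ : x₂ * y₂ = 0)).resolve_left fun h => ?_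
        · linarith
        · rw [h] at hx'; norm_num at hx'
      subst hz
      have hy' : y₁ ^ 2 = 1 := by linarith
    | have hx' : x₁ ^ 2 = 1 := by linarith
      have hz : y₁ = 0 := by
        refine (mul_eq_zero.1 (?_ : x₁ * y₁ = 0)).resolve_left fun h => ?_
        · linarith
        · rw [h] at hx'; norm_num at hx'
      subst hz
      have hy' : y₂ ^ 2 = 1 := by linarith
  · rw [hX, hY]
    have : u • D.e₁ m + v • D.e₂ m = (u * y₁ ^ 2) • D.e₁ m + (v * x₂ ^ 2) • D.e₂ m := by
      rw [hx', hy', mul_one, mul_one]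
    rw [this]
    module
  · rw [hX, hY]
    have : u • D.e₁ m + v • D.e₂ m = (u * x₁ ^ 2) • D.e₁ m + (v * y₂ ^ 2) • D.e₂ m := by
      rw [hx', hy', mul_one, mul_one]
    rw [this]
    module
  · linear_combination v ^ 2 * hx' + u ^ 2 * hy'
  · linear_combination u ^ 2 * hx' + v ^ 2 * hy'
  · linear_combination u ^ 2 * v ^ 2 * y₁ ^ 2 * hx' + u ^ 2 * v ^ 2 * hy'
  · linear_combination u ^ 2 * v ^ 2 * y₂ ^ 2 * hx' + u ^ 2 * v ^ 2 * hy'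

/-- The frame is compared with the standard one pointwise, so `f` could be `g` at one point and `1 -
g` at another. The comparison therefore goes through `f (1 - f) = g (1 - g)`, and continuity on the
interval then makes each of `f`, `g` constant when the other is. -/
theorem isDarbouxCurve_iff [CompleteSpace V] {ν X₁ X₂ : E → E}
    (hF : IsPrincipalFrame D.X D.surface ν X₁ X₂) (I : Set ℝ) (c : ℝ → E) :
    IsDarbouxCurve D.X D.surface I c ↔ ∃ α ∈ Ioc (-(Real.pi / 2)) (Real.pi / 2),
      IsArcOfLeaf (plusField X₁ X₂ α) D.surface I c ∨
      IsArcOfLeaf (minusField X₁ X₂ α) D.surface I c := by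
  by_cases hc : IsRegularCurveOn D.surface I c
  swap
  · refine ⟨fun h => absurd h.1 hc, ?_⟩
    rintro ⟨α, -, h | h⟩ <;> exact absurd h.1 hc
  obtain ⟨u, v, huv⟩ := exists_isVelocity hc
  have hO := hF.isOrthonormalFrame
  set x : ℝ → ℝ := fun t => inner ℝ (deriv c t) (X₁ (c t)) with hx
  set y : ℝ → ℝ := fun t => inner ℝ (deriv c t) (X₂ (c t)) with hy
  have hc' : ContinuousOn (deriv c) I :=
    (hc.contDiffOn.deriv_of_isOpen (m := 2) hc.isOpen (by norm_num)).continuousOn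
  have hcont : ContinuousOn c I := hc.contDiffOn.continuousOn
  have hxc : ContinuousOn x I := hc'.inner (hF.continuousOn_fst.comp hcont hc.mapsTo)
  have hyc : ContinuousOn y I := hc'.inner (hF.continuousOn_snd.comp hcont hc.mapsTo)
  have key : ∀ t ∈ I, deriv c t = x t • X₁ (c t) + y t • X₂ (c t) ∧
      x t ^ 2 + y t ^ 2 = D.sq (c t) * (u t ^ 2 + v t ^ 2) ∧
      (x t * y t) ^ 2 = D.sq (c t) ^ 2 * (u t * v t) ^ 2 := by
    intro t ht
    have hm := hc.mapsTo ht
    obtain ⟨x', y', h1, h2, h3⟩ := frame_coordinates_sq hF hm (√(D.sq (c t)) * u t)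
      (√(D.sq (c t)) * v t)
    have hd : deriv c t = x' • X₁ (c t) + y' • X₂ (c t) := by
      rw [← h1, huv.deriv_eq t ht]
      module
    have h4 := hO.coord_eq hm x' y'
    have hs := Real.sq_sqrt (sq_pos hm).le
    have hxt : x t = x' := by rw [hx]; simp only [hd, h4.1]
    have hyt : y t = y' := by rw [hy]; simp only [hd, h4.2]
    rw [hxt, hyt]
    refine ⟨hd, ?_, ?_⟩
    · rw [h2, mul_pow, mul_pow, hs]
      ring
    · rw [h3]
      linear_combination (u t ^ 2 * v t ^ 2 * (√(D.sq (c t)) ^ 2 + D.sq (c t))) * hs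
  have hpos := fun t (ht : t ∈ I) => sq_add_sq_pos hc huv ht
  have hpos' : ∀ t ∈ I, 0 < x t ^ 2 + y t ^ 2 := fun t ht => by
    rw [(key t ht).2.1]
    exact mul_pos (sq_pos (hc.mapsTo ht)) (hpos t ht)
  rw [exists_isArcOfLeaf_iff hO hc hxc hyc fun t ht => (key t ht).1,
    isDarbouxCurve_iff_const hc huv]
  set f : ℝ → ℝ := fun t => v t ^ 2 / (u t ^ 2 + v t ^ 2) with hf
  set g : ℝ → ℝ := fun t => y t ^ 2 / (x t ^ 2 + y t ^ 2) with hg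
  have hfg : ∀ t ∈ I, f t * (1 - f t) = g t * (1 - g t) := by
    intro t ht
    have h1 : f t * (1 - f t) = (u t * v t) ^ 2 / (u t ^ 2 + v t ^ 2) ^ 2 := by
      have := (hpos t ht).ne'
      simp only [hf]
      field_simp
      ring
    have h2 : g t * (1 - g t) = (x t * y t) ^ 2 / (x t ^ 2 + y t ^ 2) ^ 2 := by
      have := (hpos' t ht).ne'
      simp only [hg]
      field_simp
      ring
    rw [h1, h2, (key t ht).2.1, (key t ht).2.2, mul_pow (D.sq (c t)),
      mul_div_mul_left _ _ (pow_ne_zero 2 (sq_pos (hc.mapsTo ht)).ne')]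
  have hfc : ContinuousOn f I := (huv.contDiffOn_snd.continuousOn.pow 2).div
    ((huv.contDiffOn_fst.continuousOn.pow 2).add (huv.contDiffOn_snd.continuousOn.pow 2))
    fun t ht => (hpos t ht).ne'
  have hgc : ContinuousOn g I := (hyc.pow 2).div ((hxc.pow 2).add (hyc.pow 2))
    fun t ht => (hpos' t ht).ne'
  obtain ⟨t₀, ht₀⟩ := hc.nonempty
  have hconn := hc.ordConnected.isPreconnected
  constructor
  · intro h
    refine ⟨g t₀, fun t ht => ?_⟩
    have h1 : g t = g t₀ := eq_of_mul_one_sub_const hconn hgc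
      (k := f t₀ * (1 - f t₀))
      (fun t ht => by rw [← hfg t ht]; simp only [hf]; rw [h t ht t₀ ht₀]) t ht t₀ ht₀
    rw [← h1]
    exact (div_mul_cancel₀ _ (hpos' t ht).ne').symm
  · rintro ⟨k, hk⟩
    have h1 : ∀ t ∈ I, g t = k := fun t ht => (div_eq_iff (hpos' t ht).ne').2 (hk t ht)
    exact eq_of_mul_one_sub_const hconn hfc (k := k * (1 - k))
      (fun t ht => by rw [hfg t ht, h1 t ht])

/-- The theorem on Darboux curves for the surfaces given by a skew pair. -/
theorem exists_frame_and_isDarbouxCurve_iff [CompleteSpace V] (D : ConeSection E V) :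
    (∃ ν X₁ X₂ : E → E, IsPrincipalFrame D.X D.surface ν X₁ X₂) ∧
      ∀ ν X₁ X₂ : E → E, IsPrincipalFrame D.X D.surface ν X₁ X₂ →
        (∀ (I : Set ℝ) (c : ℝ → E),
          IsDarbouxCurve D.X D.surface I c ↔
            ∃ α ∈ Set.Ioc (-(Real.pi / 2)) (Real.pi / 2),
              IsArcOfLeaf (plusField X₁ X₂ α) D.surface I c ∨
              IsArcOfLeaf (minusField X₁ X₂ α) D.surface I c) ∧
        (∀ L : Set E,
          IsMaximalDarbouxCurve D.X D.surface L ↔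
            ∃ α ∈ Set.Ioc (-(Real.pi / 2)) (Real.pi / 2),
              IsLeaf (plusField X₁ X₂ α) D.surface L ∨
              IsLeaf (minusField X₁ X₂ α) D.surface L) :=
  ⟨⟨_, _, _, D.isPrincipalFrame⟩, fun _ _ _ hF => ⟨isDarbouxCurve_iff hF, fun L =>
    isMaximalTrace_iff_exists_isLeaf hF.isOrthonormalFrame (isDarbouxCurve_iff hF) L⟩⟩

end ConeSection

/-! ### The Lorentz space and its light rays -/

/-- The inner product of `ℝ⁴`. -/
def innerForm : E4 →L[ℝ] E4 →L[ℝ] ℝ := innerSL ℝ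

/-- The bilinear form of the Lorentz quadratic form. -/
def lorentzForm : (ℝ × E4) →L[ℝ] (ℝ × E4) →L[ℝ] ℝ :=
  innerForm.bilinearComp (.snd ℝ ℝ E4) (.snd ℝ ℝ E4) -
    (ContinuousLinearMap.mul ℝ ℝ).bilinearComp (.fst ℝ ℝ E4) (.fst ℝ ℝ E4)

theorem lorentzForm_apply (p q : ℝ × E4) :
    lorentzForm p q = inner ℝ p.2 q.2 - p.1 * q.1 := rfl

theorem lorentzForm_self (p : ℝ × E4) : lorentzForm p p = lorentz p := by
  rw [lorentzForm_apply, lorentz, real_inner_self_eq_norm_sq, sq p.1]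

theorem lorentzForm_coord (p q : ℝ × E4) : lorentzForm p q =
    p.2 0 * q.2 0 + p.2 1 * q.2 1 + p.2 2 * q.2 2 + p.2 3 * q.2 3 - p.1 * q.1 := by
  rw [lorentzForm_apply]
  simp only [PiLp.inner_apply, Fin.sum_univ_four, RCLike.inner_apply, conj_trivial]
  ring

theorem lorentzForm_symm (p q : ℝ × E4) : lorentzForm p q = lorentzForm q p := by
  rw [lorentzForm_coord, lorentzForm_coord]
  ring

theorem ext_coord {p q : ℝ × E4} (h : p.1 = q.1) (h0 : p.2 0 = q.2 0) (h1 : p.2 1 = q.2 1)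
    (h2 : p.2 2 = q.2 2) (h3 : p.2 3 = q.2 3) : p = q := by
  refine Prod.ext h ?_
  ext i
  fin_cases i <;> assumption

theorem finrank_lorentz : Module.finrank ℝ (ℝ × E4) = 5 := by
  rw [Module.finrank_prod, Module.finrank_self, finrank_euclideanSpace_fin]

/-- The light rays on which the squares of `T₁` and `T₂` are equal and positive. -/
def OnRays (T₁ T₂ : (ℝ × E4) →L[ℝ] (ℝ × E4)) (p : ℝ × E4) : Prop :=
  lorentzForm (T₂ p) (T₂ p) = lorentzForm (T₁ p) (T₁ p) ∧ 0 < lorentzForm (T₁ p) (T₁ p)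

theorem onRays_smul_iff (T₁ T₂ : (ℝ × E4) →L[ℝ] (ℝ × E4)) {k : ℝ} (hk : k ≠ 0) (p : ℝ × E4) :
    OnRays T₁ T₂ (k • p) ↔ OnRays T₁ T₂ p := by
  have h : 0 < k * k := mul_self_pos.2 hk
  simp only [OnRays, map_smul, smul_apply, smul_eq_mul, ← mul_assoc]
  rw [mul_right_inj' h.ne', mul_pos_iff_of_pos_left h]

/-- The points of `S³` on these light rays. -/
def raySurface (T₁ T₂ : (ℝ × E4) →L[ℝ] (ℝ × E4)) : Set E4 :=
  {x | x ∈ S3 ∧ OnRays T₁ T₂ (1, x)}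

theorem mem_S3_iff (x : E4) : x ∈ S3 ↔ lorentzForm (1, x) (1, x) = 0 := by
  rw [lorentzForm_self, lorentz, S3, mem_sphere_zero_iff_norm]
  simp only [one_pow, sub_eq_zero]
  constructor
  · intro h
    rw [h, one_pow]
  · intro h
    have := norm_nonneg x
    nlinarith

/-! ### `S³` as a section of the light cone -/

section Sphere

theorem isTangentVector_S3 {x w : E4} (hx : x ∈ S3) (hxw : inner ℝ x w = (0 : ℝ)) (hw : ‖w‖ = 1) :
    IsTangentVector S3 x w := by
  refine ⟨fun t => Real.cos t • x + Real.sin t • w, by simp, Eventually.of_forall fun t => ?_, ?_⟩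
  · have hx' : ‖x‖ = 1 := mem_sphere_zero_iff_norm.1 hx
    rw [S3, mem_sphere_zero_iff_norm, ← sq_eq_sq₀ (norm_nonneg _) zero_le_one, norm_add_sq_real,
      norm_smul, norm_smul, real_inner_smul_left, real_inner_smul_right, hxw, hx', hw, mul_one,
      mul_one, Real.norm_eq_abs, Real.norm_eq_abs, sq_abs, sq_abs]
    linarith [Real.cos_sq_add_sin_sq t]
  · have h := ((Real.hasDerivAt_cos 0).smul_const x).add ((Real.hasDerivAt_sin 0).smul_const w)
    exact h.congr_deriv (by simp)

/-- The section of the light cone that gives the metric of `S³`. -/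
def sphereSection {T₁ T₂ : (ℝ × E4) →L[ℝ] (ℝ × E4)} {a b : ℝ}
    (h : IsSkewPair lorentzForm T₁ T₂ a b) : ConeSection E4 (ℝ × E4) where
  X := S3
  lift x := (1, x)
  proj := .snd ℝ ℝ E4
  height := .fst ℝ ℝ E4
  B := lorentzForm
  T₁ := T₁
  T₂ := T₂
  a := a
  b := b
  skew := h
  contDiff_lift := contDiff_const.prodMk contDiff_id
  null_lift x hx := (mem_S3_iff x).1 hx
  height_lift _ _ := rfl
  proj_lift _ _ := rfl
  proj_mem G h0 h1 := by
    have hG : G = (1, G.2) := Prod.ext h1 rfl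
    rw [hG] at h0
    exact (mem_S3_iff _).2 h0
  lift_proj G _ h1 := Prod.ext h1.symm rfl
  inner_proj W W' h0 _ := by
    have h0' : W.1 = 0 := h0
    rw [lorentzForm_apply, h0', zero_mul, sub_zero]
    rfl
  isTangentVector_proj x hx W h0 h1 h2 := by
    have h1' : W.1 = 0 := h1
    rw [lorentzForm_apply, h1', mul_zero, sub_zero] at h0
    rw [lorentzForm_self, lorentz, h1'] at h2
    refine isTangentVector_S3 hx h0 ?_
    have := norm_nonneg W.2
    simp only [ContinuousLinearMap.coe_snd']
    nlinarith
  -- On the unit sphere the quadratic term is the constant `a`.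
  exists_dual a b d := ⟨(-(a + d), b), fun x hx => by
    rw [sphereEq, mem_sphere_zero_iff_norm.1 hx, lorentzForm_apply]
    ring⟩
  exists_sphereEq σ := ⟨0, σ.2, -σ.1, fun x hx => by
    rw [sphereEq, lorentzForm_apply]
    ring⟩

theorem sphereSection_surface {T₁ T₂ : (ℝ × E4) →L[ℝ] (ℝ × E4)} {a b : ℝ}
    (h : IsSkewPair lorentzForm T₁ T₂ a b) : (sphereSection h).surface = raySurface T₁ T₂ := rfl

end Sphere

/-! ### `ℝ³` as a section of the light cone, and stereographic projection -/

section Euclidean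

/-- The embedding of `ℝ³` into the light cone. -/
def paraboloid (x : E3) : ℝ × E4 :=
  ((‖x‖ ^ 2 + 1) / 2, !₂[x 0, x 1, x 2, (‖x‖ ^ 2 - 1) / 2])

theorem norm_sq_E3 (x : E3) : ‖x‖ ^ 2 = x 0 ^ 2 + x 1 ^ 2 + x 2 ^ 2 := by
  simp [EuclideanSpace.norm_sq_eq, Fin.sum_univ_three]

theorem lorentzForm_paraboloid (p : ℝ × E4) (x : E3) : lorentzForm p (paraboloid x) =
    p.2 0 * x 0 + p.2 1 * x 1 + p.2 2 * x 2 + p.2 3 * ((‖x‖ ^ 2 - 1) / 2) -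
      p.1 * ((‖x‖ ^ 2 + 1) / 2) := by
  rw [lorentzForm_coord]
  simp [paraboloid]

theorem paraboloid_null (x : E3) : lorentzForm (paraboloid x) (paraboloid x) = 0 := by
  rw [lorentzForm_paraboloid]
  have := norm_sq_E3 x
  simp only [paraboloid, Fin.isValue, Matrix.cons_val]
  linear_combination -this

theorem contDiff_paraboloid : ContDiff ℝ 3 paraboloid := by
  have hn : ContDiff ℝ 3 fun x : E3 => ‖x‖ ^ 2 := contDiff_norm_sq ℝ
  have hc : ∀ i : Fin 3, ContDiff ℝ 3 fun x : E3 => x i := fun i =>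
    (EuclideanSpace.proj (𝕜 := ℝ) i).contDiff
  refine ContDiff.prodMk ((hn.add contDiff_const).div_const 2) (contDiff_euclidean.2 fun i => ?_)
  fin_cases i
  · exact hc 0
  · exact hc 1
  · exact hc 2
  · exact (hn.sub contDiff_const).div_const 2

/-- The projection onto the coordinates of `ℝ³`. -/
def spaceProj : (ℝ × E4) →L[ℝ] E3 :=
  LinearMap.toContinuousLinearMap
    { toFun := fun p => !₂[p.2 0, p.2 1, p.2 2]
      map_add' := fun p q => by ext i; fin_cases i <;> simp
      map_smul' := fun k p => by ext i; fin_cases i <;> simp }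

theorem spaceProj_apply (p : ℝ × E4) : spaceProj p = !₂[p.2 0, p.2 1, p.2 2] := rfl

/-- The linear form that is equal to `1` on the image of `ℝ³`. -/
def spaceHeight : (ℝ × E4) →L[ℝ] ℝ :=
  .fst ℝ ℝ E4 - (EuclideanSpace.proj (3 : Fin 4)).comp (.snd ℝ ℝ E4)

theorem spaceHeight_apply (p : ℝ × E4) : spaceHeight p = p.1 - p.2 3 := rfl

theorem paraboloid_spaceProj {G : ℝ × E4} (h0 : lorentzForm G G = 0) (h1 : spaceHeight G = 1) :
    paraboloid (spaceProj G) = G := by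
  rw [lorentzForm_coord] at h0
  rw [spaceHeight_apply] at h1
  have hn : ‖spaceProj G‖ ^ 2 = 2 * G.2 3 + 1 := by
    rw [norm_sq_E3, spaceProj_apply]
    simp only [Fin.isValue, Matrix.cons_val]
    have h2 : G.1 = G.2 3 + 1 := by linarith
    rw [h2] at h0
    linear_combination h0
  refine ext_coord ?_ ?_ ?_ ?_ ?_
  · simp only [paraboloid, hn]
    linarith
  · simp [paraboloid, spaceProj_apply]
  · simp [paraboloid, spaceProj_apply]
  · simp [paraboloid, spaceProj_apply]
  · simp [paraboloid, hn]

/-- The section of the light cone that gives the metric of `ℝ³`. -/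
def spaceSection {T₁ T₂ : (ℝ × E4) →L[ℝ] (ℝ × E4)} {a b : ℝ}
    (h : IsSkewPair lorentzForm T₁ T₂ a b) : ConeSection E3 (ℝ × E4) where
  X := univ
  lift := paraboloid
  proj := spaceProj
  height := spaceHeight
  B := lorentzForm
  T₁ := T₁
  T₂ := T₂
  a := a
  b := b
  skew := h
  contDiff_lift := contDiff_paraboloid
  null_lift x _ := paraboloid_null x
  height_lift x _ := by
    simp only [spaceHeight_apply, paraboloid, Fin.isValue, Matrix.cons_val]
    ring
  proj_lift x _ := by
    ext i
    fin_cases i <;> simp [spaceProj_apply, paraboloid]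
  proj_mem _ _ _ := mem_univ _
  lift_proj G h0 h1 := paraboloid_spaceProj h0 h1
  inner_proj W W' h0 h1 := by
    rw [spaceHeight_apply] at h0 h1
    rw [lorentzForm_coord]
    simp only [PiLp.inner_apply, Fin.sum_univ_three, RCLike.inner_apply, conj_trivial,
      spaceProj_apply, Fin.isValue, Matrix.cons_val]
    linear_combination W'.1 * h0 + W.2 3 * h1
  isTangentVector_proj x _ W _ _ _ := by
    refine ⟨fun t => x + t • spaceProj W, by simp, by simp, ?_⟩
    exact (((hasDerivAt_id (0 : ℝ)).smul_const (spaceProj W)).const_add x).congr_deriv (by simp)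
  -- The time and last coordinates of `σ` are found by matching the coefficient of `‖x‖²` and the
  -- constant term.
  exists_dual a b d := ⟨(-a - d, !₂[b 0, b 1, b 2, a - d]), fun x _ => by
    rw [sphereEq, lorentzForm_paraboloid]
    simp only [PiLp.inner_apply, Fin.sum_univ_three, RCLike.inner_apply, conj_trivial,
      Fin.isValue, Matrix.cons_val]
    ring⟩
  exists_sphereEq σ := ⟨(σ.2 3 - σ.1) / 2, !₂[σ.2 0, σ.2 1, σ.2 2], -(σ.2 3 + σ.1) / 2,
    fun x _ => by
    rw [sphereEq, lorentzForm_paraboloid]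
    simp only [PiLp.inner_apply, Fin.sum_univ_three, RCLike.inner_apply, conj_trivial,
      Fin.isValue, Matrix.cons_val]
    ring⟩

/-- Stereographic projection slides points along light rays from one section of the cone to the
other, so conditions on rays transfer unchanged. -/
theorem one_invStereo (x : E3) :
    ((1, invStereo x) : ℝ × E4) = (2 / (‖x‖ ^ 2 + 1)) • paraboloid x := by
  have h : ‖x‖ ^ 2 + 1 ≠ 0 := by positivity
  refine ext_coord ?_ ?_ ?_ ?_ ?_ <;>
    simp only [paraboloid, invStereo, Prod.smul_mk, PiLp.smul_apply, Fin.isValue, PiLp.toLp_apply,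
      Matrix.cons_val, smul_eq_mul] <;> field_simp

theorem invStereo_mem_S3 (x : E3) : invStereo x ∈ S3 := by
  rw [mem_S3_iff, one_invStereo]
  simp [paraboloid_null]

theorem onRays_invStereo_iff (T₁ T₂ : (ℝ × E4) →L[ℝ] (ℝ × E4)) (x : E3) :
    OnRays T₁ T₂ (1, invStereo x) ↔ OnRays T₁ T₂ (paraboloid x) := by
  rw [one_invStereo, onRays_smul_iff]
  positivity

/-- The ray of `y` meets the paraboloid at the vector of `spaceHeight` `1`, which exists unless `y`
is the north pole. -/
theorem exists_invStereo_eq {y : E4} (hy : y ∈ S3) (h3 : y 3 ≠ 1) : ∃ x, invStereo x = y := by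
  have h3' : 1 - y 3 ≠ 0 := sub_ne_zero.2 h3.symm
  set G : ℝ × E4 := (1 - y 3)⁻¹ • (1, y) with hG
  have h0 : lorentzForm G G = 0 := by
    rw [hG, map_smul, map_smul, smul_apply, (mem_S3_iff y).1 hy, smul_zero, smul_zero]
  have h1 : spaceHeight G = 1 := by
    rw [hG, map_smul, spaceHeight_apply, smul_eq_mul, inv_mul_cancel₀ h3']
  have h2 := one_invStereo (spaceProj G)
  rw [paraboloid_spaceProj h0 h1] at h2
  have h4 : 1 = 2 / (‖spaceProj G‖ ^ 2 + 1) * ((1 - y 3)⁻¹ * 1) := congrArg Prod.fst h2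
  have h5 : invStereo (spaceProj G) = (2 / (‖spaceProj G‖ ^ 2 + 1)) • ((1 - y 3)⁻¹ • y) :=
    congrArg Prod.snd h2
  rw [mul_one] at h4
  rw [smul_smul, ← h4, one_smul] at h5
  exact ⟨_, h5⟩

theorem spaceSection_surface {T₁ T₂ : (ℝ × E4) →L[ℝ] (ℝ × E4)} {a b : ℝ}
    (h : IsSkewPair lorentzForm T₁ T₂ a b) :
    (spaceSection h).surface = invStereo ⁻¹' raySurface T₁ T₂ := by
  ext x
  have h1 : x ∈ (spaceSection h).surface ↔ x ∈ univ ∧ OnRays T₁ T₂ (paraboloid x) := Iff.rfl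
  rw [h1, mem_preimage, raySurface, mem_ofPred_eq, onRays_invStereo_iff]
  simp [invStereo_mem_S3]

theorem invStereo_image_eq {T₁ T₂ : (ℝ × E4) →L[ℝ] (ℝ × E4)} {K : Set E3}
    (h3 : ∀ y ∈ S3, OnRays T₁ T₂ (1, y) → y 3 ≠ 1)
    (hK : ∀ x, OnRays T₁ T₂ (paraboloid x) ↔ x ∈ K) : invStereo '' K = raySurface T₁ T₂ := by
  ext y
  constructor
  · rintro ⟨x, hx, rfl⟩
    exact ⟨invStereo_mem_S3 x, (onRays_invStereo_iff _ _ x).2 ((hK x).2 hx)⟩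
  · rintro ⟨hy, hr⟩
    obtain ⟨x, rfl⟩ := exists_invStereo_eq hy (h3 y hy hr)
    exact ⟨x, (hK x).1 ((onRays_invStereo_iff _ _ x).1 hr), rfl⟩

end Euclidean

/-! ### Skew pairs of the model cyclides and of their Möbius images -/

section Models

/-- The infinitesimal rotation of speed `s` in the plane of the first two space coordinates. -/
def rotation₁ (s : ℝ) : (ℝ × E4) →L[ℝ] (ℝ × E4) :=
  LinearMap.toContinuousLinearMap
    { toFun := fun p => (0, !₂[-(s * p.2 1), s * p.2 0, 0, 0])
      map_add' := fun p q => by refine ext_coord ?_ ?_ ?_ ?_ ?_ <;> simp <;> ring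
      map_smul' := fun k p => by refine ext_coord ?_ ?_ ?_ ?_ ?_ <;> simp <;> ring }

/-- The infinitesimal rotation of speed `s` in the plane of the last two space coordinates. -/
def rotation₂ (s : ℝ) : (ℝ × E4) →L[ℝ] (ℝ × E4) :=
  LinearMap.toContinuousLinearMap
    { toFun := fun p => (0, !₂[0, 0, -(s * p.2 3), s * p.2 2])
      map_add' := fun p q => by refine ext_coord ?_ ?_ ?_ ?_ ?_ <;> simp <;> ring
      map_smul' := fun k p => by refine ext_coord ?_ ?_ ?_ ?_ ?_ <;> simp <;> ring }

/-- The infinitesimal translation of `ℝ³` along the third axis. -/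
def translation : (ℝ × E4) →L[ℝ] (ℝ × E4) :=
  LinearMap.toContinuousLinearMap
    { toFun := fun p => (p.2 2, !₂[0, 0, p.1 - p.2 3, p.2 2])
      map_add' := fun p q => by refine ext_coord ?_ ?_ ?_ ?_ ?_ <;> simp; ring
      map_smul' := fun k p => by refine ext_coord ?_ ?_ ?_ ?_ ?_ <;> simp; ring }

/-- The infinitesimal homothety of `ℝ³`. -/
def homothety : (ℝ × E4) →L[ℝ] (ℝ × E4) :=
  LinearMap.toContinuousLinearMap
    { toFun := fun p => (p.2 3, !₂[0, 0, 0, p.1])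
      map_add' := fun p q => by refine ext_coord ?_ ?_ ?_ ?_ ?_ <;> simp
      map_smul' := fun k p => by refine ext_coord ?_ ?_ ?_ ?_ ?_ <;> simp }

theorem rotation₁_apply (s : ℝ) (p : ℝ × E4) :
    rotation₁ s p = (0, !₂[-(s * p.2 1), s * p.2 0, 0, 0]) := rfl

theorem rotation₂_apply (s : ℝ) (p : ℝ × E4) :
    rotation₂ s p = (0, !₂[0, 0, -(s * p.2 3), s * p.2 2]) := rfl

theorem translation_apply (p : ℝ × E4) :
    translation p = (p.2 2, !₂[0, 0, p.1 - p.2 3, p.2 2]) := rfl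

theorem homothety_apply (p : ℝ × E4) : homothety p = (p.2 3, !₂[0, 0, 0, p.1]) := rfl

theorem rotation₁_skew (s : ℝ) (p q : ℝ × E4) :
    lorentzForm (rotation₁ s p) q = -lorentzForm p (rotation₁ s q) := by
  simp only [lorentzForm_coord, rotation₁_apply, Fin.isValue, Matrix.cons_val]
  ring

theorem rotation₁_cube (s : ℝ) (p : ℝ × E4) :
    rotation₁ s (rotation₁ s (rotation₁ s p)) = -(s ^ 2 • rotation₁ s p) := by
  refine ext_coord ?_ ?_ ?_ ?_ ?_ <;>
    simp [rotation₁_apply] <;> ring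

theorem isSkewPair_torus {s s' : ℝ} (hs : 0 < s) :
    IsSkewPair lorentzForm (rotation₁ s) (rotation₂ s') (s ^ 2) (s' ^ 2) where
  finrank_eq := finrank_lorentz
  symm := lorentzForm_symm
  skew_fst := rotation₁_skew s
  skew_snd p q := by
    simp only [lorentzForm_coord, rotation₂_apply, Fin.isValue, Matrix.cons_val]
    ring
  fst_snd p := by refine ext_coord ?_ ?_ ?_ ?_ ?_ <;> simp [rotation₁_apply, rotation₂_apply]
  snd_fst p := by refine ext_coord ?_ ?_ ?_ ?_ ?_ <;> simp [rotation₁_apply, rotation₂_apply]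
  fst_cube := rotation₁_cube s
  snd_cube p := by
    refine ext_coord ?_ ?_ ?_ ?_ ?_ <;> simp [rotation₂_apply] <;> ring
  add_pos := by positivity

/-- The translation is nilpotent with zero cube, whence `b = 0`. -/
theorem isSkewPair_cylinder {s : ℝ} (hs : 0 < s) :
    IsSkewPair lorentzForm (rotation₁ s) translation (s ^ 2) 0 where
  finrank_eq := finrank_lorentz
  symm := lorentzForm_symm
  skew_fst := rotation₁_skew s
  skew_snd p q := by
    simp only [lorentzForm_coord, translation_apply, Fin.isValue, Matrix.cons_val]
    ring
  fst_snd p := by refine ext_coord ?_ ?_ ?_ ?_ ?_ <;> simp [rotation₁_apply, translation_apply]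
  snd_fst p := by refine ext_coord ?_ ?_ ?_ ?_ ?_ <;> simp [rotation₁_apply, translation_apply]
  fst_cube := rotation₁_cube s
  snd_cube p := by refine ext_coord ?_ ?_ ?_ ?_ ?_ <;> simp [translation_apply]
  add_pos := by positivity

/-- The homothety is a Lorentz boost, whose cube is itself, whence `b = -1`. The condition on `s` is
`a + b > 0`. -/
theorem isSkewPair_cone {s : ℝ} (hs : 1 < s ^ 2) :
    IsSkewPair lorentzForm (rotation₁ s) homothety (s ^ 2) (-1) where
  finrank_eq := finrank_lorentz
  symm := lorentzForm_symm
  skew_fst := rotation₁_skew s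
  skew_snd p q := by
    simp only [lorentzForm_coord, homothety_apply, Fin.isValue, Matrix.cons_val]
    ring
  fst_snd p := by refine ext_coord ?_ ?_ ?_ ?_ ?_ <;> simp [rotation₁_apply, homothety_apply]
  snd_fst p := by refine ext_coord ?_ ?_ ?_ ?_ ?_ <;> simp [rotation₁_apply, homothety_apply]
  fst_cube := rotation₁_cube s
  snd_cube p := by refine ext_coord ?_ ?_ ?_ ?_ ?_ <;> simp [homothety_apply]
  add_pos := by linarith

theorem sq_rotation₁ (s : ℝ) (p : ℝ × E4) :
    lorentzForm (rotation₁ s p) (rotation₁ s p) = s ^ 2 * (p.2 0 ^ 2 + p.2 1 ^ 2) := by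
  simp only [lorentzForm_coord, rotation₁_apply, Fin.isValue, Matrix.cons_val]
  ring

theorem sq_rotation₂ (s : ℝ) (p : ℝ × E4) :
    lorentzForm (rotation₂ s p) (rotation₂ s p) = s ^ 2 * (p.2 2 ^ 2 + p.2 3 ^ 2) := by
  simp only [lorentzForm_coord, rotation₂_apply, Fin.isValue, Matrix.cons_val]
  ring

theorem sq_translation (p : ℝ × E4) :
    lorentzForm (translation p) (translation p) = (p.1 - p.2 3) ^ 2 := by
  simp only [lorentzForm_coord, translation_apply, Fin.isValue, Matrix.cons_val]
  ring

theorem sq_homothety (p : ℝ × E4) :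
    lorentzForm (homothety p) (homothety p) = p.1 ^ 2 - p.2 3 ^ 2 := by
  simp only [lorentzForm_coord, homothety_apply, Fin.isValue, Matrix.cons_val]
  ring

theorem norm_sq_E4 (x : E4) : ‖x‖ ^ 2 = x 0 ^ 2 + x 1 ^ 2 + x 2 ^ 2 + x 3 ^ 2 := by
  simp [EuclideanSpace.norm_sq_eq, Fin.sum_univ_four]

theorem inner_greatCircle {x y : E4} (hy : y ∈ greatCircle) :
    inner ℝ x y = x 0 * y 0 + x 1 * y 1 ∧ y 0 ^ 2 + y 1 ^ 2 = 1 := by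
  obtain ⟨h1, h2, h3⟩ := hy
  constructor
  · simp only [PiLp.inner_apply, Fin.sum_univ_four, RCLike.inner_apply, conj_trivial, h2, h3]
    ring
  · have := norm_sq_E4 y
    rw [mem_sphere_zero_iff_norm.1 h1, h2, h3] at this
    linarith

theorem angle_eq_arccos {x y : E4} (hx : x ∈ S3) (hy : y ∈ S3) :
    InnerProductGeometry.angle x y = Real.arccos (inner ℝ x y) := by
  rw [InnerProductGeometry.angle, mem_sphere_zero_iff_norm.1 hx, mem_sphere_zero_iff_norm.1 hy,
    mul_one, div_one]

/-- By Cauchy–Schwarz in the plane of the circle, the largest value of `⟪x, y⟫` over the circle is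
`√(x₀² + x₁²)`, and it is the cosine of the distance. -/
theorem mem_geodesicTube_iff {r : ℝ} (h0 : 0 < r) (h1 : r < Real.pi / 2) (x : E4) :
    x ∈ geodesicTube r ↔ x ∈ S3 ∧ x 0 ^ 2 + x 1 ^ 2 = Real.cos r ^ 2 := by
  have hpi := Real.pi_pos
  have hcos : 0 < Real.cos r := Real.cos_pos_of_mem_Ioo ⟨by linarith, h1⟩
  have hle : ∀ y ∈ greatCircle, inner ℝ x y ^ 2 ≤ x 0 ^ 2 + x 1 ^ 2 := fun y hy => by
    obtain ⟨e1, e2⟩ := inner_greatCircle (x := x) hy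
    rw [e1]
    nlinarith [sq_nonneg (x 0 * y 1 - x 1 * y 0)]
  have hex : 0 < x 0 ^ 2 + x 1 ^ 2 → ∃ y ∈ greatCircle, inner ℝ x y = √(x 0 ^ 2 + x 1 ^ 2) := by
    intro hpos
    set ρ := √(x 0 ^ 2 + x 1 ^ 2) with hρ
    have hρ0 : 0 < ρ := Real.sqrt_pos.2 hpos
    have hρ2 : ρ ^ 2 = x 0 ^ 2 + x 1 ^ 2 := Real.sq_sqrt hpos.le
    have hy : !₂[x 0 / ρ, x 1 / ρ, 0, 0] ∈ greatCircle := by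
      refine ⟨?_, rfl, rfl⟩
      rw [S3, mem_sphere_zero_iff_norm, ← sq_eq_sq₀ (norm_nonneg _) zero_le_one, norm_sq_E4]
      simp only [Fin.isValue, Matrix.cons_val]
      field_simp
      linarith
    refine ⟨_, hy, ?_⟩
    rw [(inner_greatCircle hy).1]
    simp only [Fin.isValue, Matrix.cons_val]
    field_simp
    linarith
  constructor
  · rintro ⟨hx, ⟨y, hy, hyr⟩, hmin⟩
    refine ⟨hx, ?_⟩
    have hxy : Real.cos r = inner ℝ x y := by
      rw [← hyr]
      simp only
      rw [InnerProductGeometry.cos_angle, mem_sphere_zero_iff_norm.1 hx,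
        mem_sphere_zero_iff_norm.1 hy.1, mul_one, div_one]
    have h2 := hle y hy
    rw [← hxy] at h2
    have hpos : 0 < x 0 ^ 2 + x 1 ^ 2 := lt_of_lt_of_le (by positivity) h2
    obtain ⟨z, hz, hxz⟩ := hex hpos
    have h3 : r ≤ InnerProductGeometry.angle x z := hmin ⟨z, hz, rfl⟩
    have h4 := Real.cos_le_cos_of_nonneg_of_le_pi h0.le (InnerProductGeometry.angle_le_pi x z) h3
    rw [InnerProductGeometry.cos_angle, mem_sphere_zero_iff_norm.1 hx,
        mem_sphere_zero_iff_norm.1 hz.1, mul_one, div_one, hxz] at h4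
    refine le_antisymm ?_ h2
    rw [← Real.sq_sqrt hpos.le]
    exact pow_le_pow_left₀ (Real.sqrt_nonneg _) h4 2
  · rintro ⟨hx, hxr⟩
    have harc : Real.arccos (Real.cos r) = r := Real.arccos_cos h0.le (by linarith)
    refine ⟨hx, ?_, ?_⟩
    · obtain ⟨y, hy, hxy⟩ := hex (by rw [hxr]; positivity)
      refine ⟨y, hy, ?_⟩
      simp only
      rw [angle_eq_arccos hx hy.1, hxy, hxr, Real.sqrt_sq hcos.le, harc]
    · rintro _ ⟨y, hy, rfl⟩
      simp only
      rw [angle_eq_arccos hx hy.1, ← harc]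
      refine Real.arccos_le_arccos ?_
      have h2 := hle y hy
      rw [hxr] at h2
      exact le_of_sq_le_sq h2 hcos.le

theorem exists_isSkewPair_of_isModelCyclide {N : Set E4} (hN : IsModelCyclide N) :
    ∃ (T₁ T₂ : (ℝ × E4) →L[ℝ] (ℝ × E4)) (a b : ℝ), IsSkewPair lorentzForm T₁ T₂ a b ∧
      N = raySurface T₁ T₂ := by
  have hpi := Real.pi_pos
  rcases hN with ⟨r, h0, h1, rfl⟩ | ⟨R, hR, rfl⟩ | ⟨θ, h0, h1, rfl⟩
  · have hcos : 0 < Real.cos r := Real.cos_pos_of_mem_Ioo ⟨by linarith, h1⟩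
    have hsin : 0 < Real.sin r := Real.sin_pos_of_pos_of_lt_pi h0 (by linarith)
    -- Speeds `1 / cos r` and `1 / sin r` make both squares equal to `1` on the tube.
    refine ⟨_, _, _, _, isSkewPair_torus (s' := (Real.sin r)⁻¹) (inv_pos.2 hcos), ?_⟩
    ext x
    rw [mem_geodesicTube_iff h0 h1, raySurface, mem_ofPred_eq, OnRays, sq_rotation₁, sq_rotation₂]
    refine and_congr_right fun hx => ?_
    have hn := norm_sq_E4 x
    rw [mem_sphere_zero_iff_norm.1 hx] at hn
    have hcs := Real.cos_sq_add_sin_sq r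
    simp only
    constructor
    · intro h
      have h2 : x 2 ^ 2 + x 3 ^ 2 = Real.sin r ^ 2 := by linarith
      rw [h, h2, inv_pow, inv_pow, inv_mul_cancel₀ (by positivity), inv_mul_cancel₀ (by positivity)]
      exact ⟨rfl, one_pos⟩
    · rintro ⟨h, -⟩
      have h2 : x 2 ^ 2 + x 3 ^ 2 = 1 - (x 0 ^ 2 + x 1 ^ 2) := by linarith
      rw [h2] at h
      field_simp at h
      linear_combination -h - (x 0 ^ 2 + x 1 ^ 2) * hcs
  -- On the paraboloid the translation has square `1`, and the rotation of speed `1 / R` has square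
  -- `1` at distance `R` from the axis. The point at infinity has square zero and is excluded by
  -- positivity.
  · refine ⟨_, _, _, _, isSkewPair_cylinder (inv_pos.2 hR), ?_⟩
    refine invStereo_image_eq (fun y _ h h3 => ?_) fun x => ?_
    · rw [OnRays, sq_translation] at h
      have h2 := h.2
      rw [← h.1] at h2
      simp [h3] at h2
    · rw [OnRays, sq_rotation₁, sq_translation, cylinder, mem_ofPred_eq]
      simp only [paraboloid, Fin.isValue, Matrix.cons_val]
      have h2 : ((‖x‖ ^ 2 + 1) / 2 - (‖x‖ ^ 2 - 1) / 2) ^ 2 = 1 := by ring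
      rw [h2]
      constructor
      · rintro ⟨h, -⟩
        field_simp at h
        linarith
      · intro h
        rw [h, inv_pow, inv_mul_cancel₀ (by positivity)]
        exact ⟨rfl, one_pos⟩
  · have hcos : 0 < Real.cos θ := Real.cos_pos_of_mem_Ioo ⟨by linarith, h1⟩
    have hsin : 0 < Real.sin θ := Real.sin_pos_of_pos_of_lt_pi h0 (by linarith)
    have hcs := Real.cos_sq_add_sin_sq θ
    have hs : 1 < (Real.sin θ)⁻¹ ^ 2 := by
      rw [inv_pow, one_lt_inv₀ (by positivity)]
      nlinarith
    -- The homothety has square `‖x‖²` on the paraboloid, so speed `1 / sin θ` gives the equation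
    -- `x₀² + x₁² = sin² θ ‖x‖²` of the cone. Positivity removes the apex.
    refine ⟨_, _, _, _, isSkewPair_cone hs, ?_⟩
    refine invStereo_image_eq (fun y _ h h3 => ?_) fun x => ?_
    · rw [OnRays, sq_homothety] at h
      have h2 := h.2
      rw [← h.1] at h2
      simp [h3] at h2
    · rw [OnRays, sq_rotation₁, sq_homothety, cone, mem_ofPred_eq]
      simp only [paraboloid, Fin.isValue, Matrix.cons_val]
      have hn := norm_sq_E3 x
      have h2 : ((‖x‖ ^ 2 + 1) / 2) ^ 2 - ((‖x‖ ^ 2 - 1) / 2) ^ 2 = ‖x‖ ^ 2 := by ring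
      have h3 : ‖x‖ ^ 2 = (Real.sin θ)⁻¹ ^ 2 * (x 0 ^ 2 + x 1 ^ 2) ↔
          x 0 ^ 2 + x 1 ^ 2 = (Real.tan θ * x 2) ^ 2 := by
        rw [Real.tan_eq_sin_div_cos, hn]
        field_simp
        constructor
        · intro h
          linear_combination -h + (x 0 ^ 2 + x 1 ^ 2) * hcs
        · intro h
          linear_combination -h + (x 0 ^ 2 + x 1 ^ 2) * hcs
      rw [h2, h3, and_comm]
      refine and_congr_left fun h => ?_
      rw [← h3.2 h, sq_pos_iff, norm_ne_zero_iff]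

/-- Conjugating the pair by the isometry keeps every algebraic relation, and `moebius A` is the
action of `A` on light rays followed by rescaling. -/
theorem moebius_image_eq {A : (ℝ × E4) →ₗ[ℝ] (ℝ × E4)} (hA : ∀ p, lorentz (A p) = lorentz p)
    {T₁ T₂ : (ℝ × E4) →L[ℝ] (ℝ × E4)} {a b : ℝ} (h : IsSkewPair lorentzForm T₁ T₂ a b) :
    ∃ T₁' T₂' : (ℝ × E4) →L[ℝ] (ℝ × E4), IsSkewPair lorentzForm T₁' T₂' a b ∧
      moebius A '' raySurface T₁ T₂ = raySurface T₁' T₂' := by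
  have hB : ∀ p q, lorentzForm (A p) (A q) = lorentzForm p q := by
    have h1 : ∀ p, lorentzForm (A p) (A p) = lorentzForm p p := fun p => by
      rw [lorentzForm_self, lorentzForm_self, hA]
    intro p q
    have h2 := h1 (p + q)
    simp only [map_add, add_apply, h1] at h2
    have h3 := lorentzForm_symm p q
    have h4 := lorentzForm_symm (A p) (A q)
    linarith
  have hinj : Function.Injective A := by
    rw [injective_iff_map_eq_zero]
    intro p hp
    -- The product of `p` with its time reflection is the positive definite `‖p.2‖² + p.1²`.
    have h1 := hB p (-p.1, p.2)
    rw [hp, map_zero, zero_apply, lorentzForm_apply, real_inner_self_eq_norm_sq] at h1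
    simp only at h1
    have h2 : p.1 = 0 := by nlinarith [sq_nonneg ‖p.2‖, sq_nonneg p.1]
    have h3 : ‖p.2‖ = 0 := by nlinarith [sq_nonneg ‖p.2‖, sq_nonneg p.1]
    exact Prod.ext h2 (norm_eq_zero.1 h3)
  let e : (ℝ × E4) ≃L[ℝ] (ℝ × E4) := (LinearEquiv.ofInjectiveEndo A hinj).toContinuousLinearEquiv
  have he : ∀ p, e p = A p := fun _ => rfl
  have hBe : ∀ p q, lorentzForm (e p) (e q) = lorentzForm p q := hB
  have hBs : ∀ p q, lorentzForm (e p) q = lorentzForm p (e.symm q) := fun p q => by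
    rw [← hBe p (e.symm q), e.apply_symm_apply]
  let conj : ((ℝ × E4) →L[ℝ] (ℝ × E4)) → (ℝ × E4) →L[ℝ] (ℝ × E4) := fun T =>
    (e : (ℝ × E4) →L[ℝ] (ℝ × E4)).comp (T.comp (e.symm : (ℝ × E4) →L[ℝ] (ℝ × E4)))
  have hconj : ∀ T p, conj T p = e (T (e.symm p)) := fun _ _ => rfl
  have hrays : ∀ p, OnRays (conj T₁) (conj T₂) p ↔ OnRays T₁ T₂ (e.symm p) := fun p => by
    simp only [OnRays, hconj, hBe]
  -- A nonzero null vector has nonzero time coordinate, so its ray meets `S³`, even if `A` reverses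
  -- time.
  have hfst : ∀ p, lorentzForm p p = 0 → p ≠ 0 → p.1 ≠ 0 ∧ p.1⁻¹ • p = (1, p.1⁻¹ • p.2) := by
    intro p hp h0
    have h1 : p.1 ≠ 0 := fun h1 => by
      rw [lorentzForm_self, lorentz, h1] at hp
      have h2 : ‖p.2‖ = 0 := by nlinarith [sq_nonneg ‖p.2‖]
      exact h0 (Prod.ext h1 (norm_eq_zero.1 h2))
    exact ⟨h1, Prod.ext (inv_mul_cancel₀ h1) rfl⟩
  have hne : ∀ x : E4, ((1, x) : ℝ × E4) ≠ 0 := fun x hx => one_ne_zero (congrArg Prod.fst hx)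
  refine ⟨conj T₁, conj T₂, ⟨h.finrank_eq, h.symm, ?_, ?_, ?_, ?_, ?_, ?_, h.add_pos⟩, ?_⟩
  · intro p q
    rw [hconj, hconj, hBs, h.skew_fst, h.symm p, hBs, h.symm]
  · intro p q
    rw [hconj, hconj, hBs, h.skew_snd, h.symm p, hBs, h.symm]
  · intro p
    rw [hconj, hconj, e.symm_apply_apply, h.fst_snd, map_zero]
  · intro p
    rw [hconj, hconj, e.symm_apply_apply, h.snd_fst, map_zero]
  · intro p
    rw [hconj, hconj, hconj, e.symm_apply_apply, e.symm_apply_apply, h.fst_cube, map_neg, map_smul]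
  · intro p
    rw [hconj, hconj, hconj, e.symm_apply_apply, e.symm_apply_apply, h.snd_cube, map_neg, map_smul]
  ext y
  constructor
  · rintro ⟨x, ⟨hx, hr⟩, rfl⟩
    have hnull : lorentzForm (e (1, x)) (e (1, x)) = 0 := by rw [hBe, (mem_S3_iff x).1 hx]
    obtain ⟨h1, h2⟩ := hfst _ hnull (e.map_ne_zero_iff.2 (hne x))
    have h3 : ((1, moebius A x) : ℝ × E4) = (e (1, x)).1⁻¹ • e (1, x) := h2.symm
    refine ⟨?_, ?_⟩
    · rw [mem_S3_iff, h3]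
      simp [hnull]
    · rw [h3, hrays, map_smul, e.symm_apply_apply, onRays_smul_iff _ _ (inv_ne_zero h1)]
      exact hr
  · rintro ⟨hy, hr⟩
    rw [hrays] at hr
    set p := e.symm (1, y) with hp
    have hep : e p = (1, y) := e.apply_symm_apply _
    have hnull : lorentzForm p p = 0 := by rw [← hBe, hep, (mem_S3_iff y).1 hy]
    obtain ⟨h1, h2⟩ := hfst p hnull (e.symm.map_ne_zero_iff.2 (hne y))
    refine ⟨p.1⁻¹ • p.2, ⟨?_, ?_⟩, ?_⟩
    · rw [mem_S3_iff, ← h2]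
      simp [hnull]
    · rw [← h2, onRays_smul_iff _ _ (inv_ne_zero h1)]
      exact hr
    · rw [moebius, ← h2, ← he, map_smul, hep]
      simp [h1]

theorem exists_isSkewPair_of_isDupinCyclideS3 {M : Set E4} (hM : IsDupinCyclideS3 M) :
    ∃ (T₁ T₂ : (ℝ × E4) →L[ℝ] (ℝ × E4)) (a b : ℝ), IsSkewPair lorentzForm T₁ T₂ a b ∧
      M = raySurface T₁ T₂ := by
  obtain ⟨N, A, hN, hA, rfl⟩ := hM
  obtain ⟨T₁, T₂, a, b, h, rfl⟩ := exists_isSkewPair_of_isModelCyclide hN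
  obtain ⟨T₁', T₂', h', heq⟩ := moebius_image_eq hA h
  exact ⟨T₁', T₂', a, b, h', heq⟩

end Models

end Cyclide

end

theorem proposition15 :
    (∀ M : Set Cyclide.E4, Cyclide.IsDupinCyclideS3 M →
      (∃ ν X₁ X₂ : Cyclide.E4 → Cyclide.E4, Cyclide.IsPrincipalFrame Cyclide.S3 M ν X₁ X₂) ∧
      ∀ ν X₁ X₂ : Cyclide.E4 → Cyclide.E4, Cyclide.IsPrincipalFrame Cyclide.S3 M ν X₁ X₂ →
        (∀ (I : Set ℝ) (c : ℝ → Cyclide.E4),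
          Cyclide.IsDarbouxCurve Cyclide.S3 M I c ↔
            ∃ α ∈ Set.Ioc (-(Real.pi / 2)) (Real.pi / 2),
              Cyclide.IsArcOfLeaf (Cyclide.plusField X₁ X₂ α) M I c ∨
              Cyclide.IsArcOfLeaf (Cyclide.minusField X₁ X₂ α) M I c) ∧
        (∀ L : Set Cyclide.E4,
          Cyclide.IsMaximalDarbouxCurve Cyclide.S3 M L ↔
            ∃ α ∈ Set.Ioc (-(Real.pi / 2)) (Real.pi / 2),
              Cyclide.IsLeaf (Cyclide.plusField X₁ X₂ α) M L ∨
              Cyclide.IsLeaf (Cyclide.minusField X₁ X₂ α) M L)) ∧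
    (∀ M : Set Cyclide.E3, Cyclide.IsDupinCyclideE3 M →
      (∃ ν X₁ X₂ : Cyclide.E3 → Cyclide.E3, Cyclide.IsPrincipalFrame Set.univ M ν X₁ X₂) ∧
      ∀ ν X₁ X₂ : Cyclide.E3 → Cyclide.E3, Cyclide.IsPrincipalFrame Set.univ M ν X₁ X₂ →
        (∀ (I : Set ℝ) (c : ℝ → Cyclide.E3),
          Cyclide.IsDarbouxCurve Set.univ M I c ↔
            ∃ α ∈ Set.Ioc (-(Real.pi / 2)) (Real.pi / 2),
              Cyclide.IsArcOfLeaf (Cyclide.plusField X₁ X₂ α) M I c ∨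
              Cyclide.IsArcOfLeaf (Cyclide.minusField X₁ X₂ α) M I c) ∧
        (∀ L : Set Cyclide.E3,
          Cyclide.IsMaximalDarbouxCurve Set.univ M L ↔
            ∃ α ∈ Set.Ioc (-(Real.pi / 2)) (Real.pi / 2),
              Cyclide.IsLeaf (Cyclide.plusField X₁ X₂ α) M L ∨
              Cyclide.IsLeaf (Cyclide.minusField X₁ X₂ α) M L)) := by
  refine ⟨fun M hM => ?_, fun M hM => ?_⟩
  · obtain ⟨T₁, T₂, a, b, h, rfl⟩ := Cyclide.exists_isSkewPair_of_isDupinCyclideS3 hM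
    rw [← Cyclide.sphereSection_surface h]
    exact Cyclide.ConeSection.exists_frame_and_isDarbouxCurve_iff (Cyclide.sphereSection h)
  · obtain ⟨N, hN, rfl⟩ := hM
    obtain ⟨T₁, T₂, a, b, h, rfl⟩ := Cyclide.exists_isSkewPair_of_isDupinCyclideS3 hN
    rw [← Cyclide.spaceSection_surface h]
    exact Cyclide.ConeSection.exists_frame_and_isDarbouxCurve_iff (Cyclide.spaceSection h)
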